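/- For a domain $D\subset\mathbb C^n$ and $z\in D$, let $$K_D(z)=\sup\Big\{|f(z)|^2 : f\in\mathcal O(D),\ \int_D|f|^2\,d\lambda\le 1\Big\}$$ be the Bergman kernel on the diagonal ($\lambda$ is Lebesgue measure), let $$k_D(z,v)=\inf\{|\alpha| : \alpha\in\mathbb C,\ \exists\,\varphi:\mathbb D\to D \text{ holomorphic with } \varphi(0)=z,\ \alpha\varphi'(0)=v\}$$ be the Kobayashi (Kobayashi--Royden) metric, let $I^k_D(z)=\{v\in\mathbb C^n : k_D(z,v)<1\}$ be its indicatrix at $z$, and set $F^k_D(z)=K_D(z)\,\lambda\big(I^k_D(z)\big)$. For $\mu>0$ let $E_{2\mu}=\{(z,w)\in\mathbb C^2 : |z|^2+|w|^{2\mu}<1\}$. Then for every $0<\mu<1/2$ and every real $p$ with $0\le p<1$: (a) $$F^k_{E_{2\mu}}(0,p)\le \frac1\mu\left(\frac{1-p^{2\mu}}{1-p^2}\right)-\frac{1-\mu}{2\mu}\,(1-p^{2\mu});$$ (b) $$F^k_{E_{2\mu}}(0,p)\ge \frac{p^{2-2\mu}}{2\mu^3}\left(\frac{1-p^{2\mu}}{1-p^2}\right)^3\left(1+\mu+p^2-\mu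 p^2\right).$$ -/

import Mathlib

open MeasureTheory Set
open scoped ENNReal

noncomputable section

/-- The Bergman kernel on the diagonal, `K_D(z) = sup {|f(z)|² : f ∈ 𝒪(D), ∫_D |f|² dλ ≤ 1}`,
for an open subset `D` of a complex normed space with a reference measure `λ = volume`. -/
def bergmanKernel {E : Type*} [NormedAddCommGroup E] [NormedSpace ℂ E] [MeasureSpace E]
    (D : Set E) (z : E) : ℝ≥0∞ :=
  ⨆ f ∈ {f : E → ℂ | DifferentiableOn ℂ f D ∧ ∫⁻ x in D, ‖f x‖ₑ ^ 2 ≤ 1}, ‖f z‖ₑ ^ 2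

/-- The Kobayashi (Kobayashi–Royden) pseudometric,
`k_D(z, v) = inf {|α| : α ∈ ℂ, ∃ φ ∈ 𝒪(𝔻, D), φ(0) = z, α φ'(0) = v}`. -/
def kobayashiMetric {E : Type*} [NormedAddCommGroup E] [NormedSpace ℂ E]
    (D : Set E) (z v : E) : ℝ≥0∞ :=
  ⨅ α ∈ {α : ℂ | ∃ φ : ℂ → E, DifferentiableOn ℂ φ (Metric.ball 0 1) ∧
    MapsTo φ (Metric.ball 0 1) D ∧ φ 0 = z ∧ α • deriv φ 0 = v}, ‖α‖ₑ

/-- The Kobayashi indicatrix `I^k_D(z) = {v : k_D(z, v) < 1}`. -/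
def kobayashiIndicatrix {E : Type*} [NormedAddCommGroup E] [NormedSpace ℂ E]
    (D : Set E) (z : E) : Set E :=
  {v | kobayashiMetric D z v < 1}

/-- The invariant `F^k_D(z) = K_D(z) λ(I^k_D(z))`. -/
def kobayashiF {E : Type*} [NormedAddCommGroup E] [NormedSpace ℂ E] [MeasureSpace E]
    (D : Set E) (z : E) : ℝ≥0∞ :=
  bergmanKernel D z * volume (kobayashiIndicatrix D z)

/-- The egg domain `E_{2μ} = {(z, w) ∈ ℂ² : |z|² + |w|^{2μ} < 1}`. -/
def eggDomain (μ : ℝ) : Set (ℂ × ℂ) :=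
  {x | ‖x.1‖ ^ 2 + ‖x.2‖ ^ (2 * μ) < 1}

end

/-!
Write `c = p ^ (2 μ)`. Both estimates are products of the exact value of the Bergman kernel
`K = (1 + μ + p² - μ p²) / (π² μ (1 - p²)³)` at `(0, p)` with the volume `π² X B² / 2` of an
ellipsoid `‖v₁‖² / X + ‖v₂‖² / B² < 1` which contains, respectively is contained in, the Kobayashi
indicatrix. In both cases `X = 1 - c`; for (a) `B = 1 - p²`, for (b) `B = p ^ (1 - μ) (1 - c) / μ`.

*The kernel.* By the sub-mean value property in the first variable only functions of the second
variable matter; the monomials `w ^ k` are orthogonal with squared norm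
`π² μ / ((k + 1) (k + 1 + μ))`, and the kernel is `∑ p ^ (2 k) / ‖w ^ k‖²`
(`bergmanKernel_eggDomain_le`, `le_bergmanKernel_eggDomain`).

*The outer ellipsoid* (`kobayashiIndicatrix_eggDomain_subset`). Let `φ = (ζ ψ, φ₂)` be a disc with
`φ(0) = (0, p)`, holomorphic past the unit circle, and let `ζ g` be `φ₂` followed by the
automorphism of the unit disc moving `p` to `0`. The function `(1 - r ^ (2 μ)) / (1 - r ^ 2)` is
log-concave and nonincreasing in `log r`, hence at most a multiple of `r ^ (-k)`, with equality at
`p` and `k ≥ 0` (`exists_one_sub_rpow_mul_rpow_le`). On the circle `‖ψ‖² ≤ 1 - ‖φ₂‖ ^ (2 μ)`, so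
`‖ψ‖² ‖φ₂‖ ^ k / ‖1 - p φ₂‖²` is at most a constant times `1 - ‖g‖²`. The left side is
log-subharmonic, and `1 - ‖g‖²` is at most a constant times the modulus of a nonvanishing
holomorphic function, with equality at `0`. The maximum principle
(`norm_mul_rpow_le_of_forall_sphere`) carries the inequality to the centre, where it reads
`‖φ₁'(0)‖² / (1 - c) + ‖φ₂'(0)‖² / (1 - p²)² ≤ 1`.

*The inner ellipsoid* (`subset_kobayashiIndicatrix_eggDomain`). Discs are given explicitly
(`kobayashiMetric_eggDomain_le`). If `‖v₂‖ ≤ p ^ μ B`, the geodesic of the unit ball through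
`(0, p ^ μ)` in the corresponding direction has a zero-free second component, and its image under
`(z, w) ↦ (z, w ^ (1 / μ))` is the disc wanted. Otherwise the second component must have a zero
`α`; it is chosen with the intermediate value theorem so that the second component of the
derivative is right, and the first component is then large enough by
`sq_one_sub_le_of_one_sub_le`, an inequality affine in the remaining parameter.
-/

/-! ### Real inequalities -/

theorem sinh_mul_le_mul_sinh {μ l : ℝ} (hμ : 0 ≤ μ) (hμ1 : μ ≤ 1) (hl : 0 ≤ l) :
    Real.sinh (μ * l) ≤ μ * Real.sinh l := by
  have hmono : MonotoneOn (fun l : ℝ => μ * Real.sinh l - Real.sinh (μ * l)) (Ici 0) := by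
    refine monotoneOn_of_hasDerivWithinAt_nonneg
      (f' := fun l => μ * Real.cosh l - Real.cosh (μ * l) * μ)
      (convex_Ici 0) (by fun_prop) ?_ ?_
    · intro x _
      have h1 : HasDerivAt (fun l : ℝ => μ * l) μ x := by
        simpa using (hasDerivAt_id x).const_mul μ
      exact (((Real.hasDerivAt_sinh x).const_mul μ).sub
        ((Real.hasDerivAt_sinh (μ * x)).comp x h1)).hasDerivWithinAt
    · intro x hx
      rw [interior_Ici] at hx
      have hx0 : 0 < x := hx
      have : Real.cosh (μ * x) ≤ Real.cosh x := by
        rw [Real.cosh_le_cosh, abs_of_nonneg (by positivity), abs_of_pos hx0]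
        nlinarith
      nlinarith
  have := hmono (mem_Ici.2 le_rfl) (mem_Ici.2 hl) hl
  simp at this
  linarith

/-- The inequality `sinh (μ l) ≤ μ sinh l` at `α = exp (-l)`. -/
theorem one_sub_rpow_mul_le {μ α : ℝ} (hμ : 0 ≤ μ) (hμ1 : μ ≤ 1) (hα : 0 < α) (hα1 : α ≤ 1) :
    (1 - α ^ (2 * μ)) * α ^ (1 - μ) ≤ μ * (1 - α ^ 2) := by
  have hl : 0 ≤ -Real.log α := by linarith [Real.log_nonpos hα.le hα1]
  have h := sinh_mul_le_mul_sinh hμ hμ1 hl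
  have e1 : Real.exp (μ * -Real.log α) = α ^ (-μ) := by
    rw [Real.rpow_def_of_pos hα]; ring_nf
  have e2 : Real.exp (-(μ * -Real.log α)) = α ^ μ := by
    rw [Real.rpow_def_of_pos hα]; ring_nf
  rw [Real.sinh_eq, Real.sinh_eq, e1, e2, neg_neg, Real.exp_neg, Real.exp_log hα] at h
  have h2 := mul_le_mul_of_nonneg_right h (by positivity : 0 ≤ 2 * α)
  have e3 : α ^ (1 - μ) = α ^ (-μ) * α := by
    rw [sub_eq_neg_add, Real.rpow_add hα, Real.rpow_one]
  have e4 : α ^ (2 * μ) * α ^ (-μ) = α ^ μ := by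
    rw [← Real.rpow_add hα]; ring_nf
  have e5 : μ * ((α⁻¹ - α) / 2) * (2 * α) = μ * (1 - α ^ 2) := by field_simp
  rw [e5] at h2
  calc _ = (α ^ (-μ) - α ^ (2 * μ) * α ^ (-μ)) * α := by rw [e3]; ring
    _ = (α ^ (-μ) - α ^ μ) / 2 * (2 * α) := by rw [e4]; ring
    _ ≤ _ := h2

/-- In terms of `l = -log α` and `ν = 1 - 2μ` this reads
`artanh (ν tanh (l / 2)) ≤ ν l / 2`. -/
theorem mul_le_rpow_mul {μ α : ℝ} (hμ : 0 ≤ μ) (hμ1 : μ ≤ 1 / 2) (hα : 0 < α) (hα1 : α ≤ 1) :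
    α * (1 - μ + μ * α) ≤ α ^ (2 * μ) * (α + μ * (1 - α)) := by
  have pos1 : ∀ x : ℝ, 0 < x → 0 < x + μ * (1 - x) := fun x hx => by nlinarith
  have pos2 : ∀ x : ℝ, 0 < x → 0 < 1 - μ + μ * x := fun x hx => by nlinarith [mul_nonneg hμ hx.le]
  have hd : ∀ x : ℝ, 0 < x → HasDerivAt
      (fun x : ℝ => Real.log (x + μ * (1 - x)) - Real.log (1 - μ + μ * x)
        - (1 - 2 * μ) * Real.log x)
      ((1 - μ) / (x + μ * (1 - x)) - μ / (1 - μ + μ * x) - (1 - 2 * μ) * x⁻¹) x := by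
    intro x hx
    have d1 : HasDerivAt (fun x : ℝ => x + μ * (1 - x)) (1 - μ) x := by
      have := (hasDerivAt_id x).add (((hasDerivAt_id x).const_sub 1).const_mul μ)
      rwa [mul_neg_one, ← sub_eq_add_neg] at this
    have d2 : HasDerivAt (fun x : ℝ => 1 - μ + μ * x) μ x := by
      simpa using ((hasDerivAt_id x).const_mul μ).const_add (1 - μ)
    exact ((d1.log (pos1 x hx).ne').sub (d2.log (pos2 x hx).ne')).sub
      ((Real.hasDerivAt_log hx.ne').const_mul _)
  have hanti : AntitoneOn (fun x : ℝ => Real.log (x + μ * (1 - x)) - Real.log (1 - μ + μ * x)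
        - (1 - 2 * μ) * Real.log x) (Ioi 0) := by
    refine antitoneOn_of_hasDerivWithinAt_nonpos (convex_Ioi 0)
      (fun x hx => (hd x hx).continuousAt.continuousWithinAt)
      (fun x hx => (hd x (interior_subset hx)).hasDerivWithinAt) ?_
    intro x hx
    have hx0 : 0 < x := interior_subset hx
    have p1 := pos1 x hx0
    have p2 := pos2 x hx0
    have : (1 - μ) / (x + μ * (1 - x)) - μ / (1 - μ + μ * x) - (1 - 2 * μ) * x⁻¹
        = -((1 - 2 * μ) * (μ * (1 - μ) * (1 - x) ^ 2)) /
          ((x + μ * (1 - x)) * (1 - μ + μ * x) * x) := by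
      field_simp
      ring
    rw [this]
    apply div_nonpos_of_nonpos_of_nonneg _ (by positivity)
    have : 0 ≤ (1 - 2 * μ) * (μ * (1 - μ) * (1 - x) ^ 2) := by
      have a : 0 ≤ 1 - 2 * μ := by linarith
      have b : 0 ≤ 1 - μ := by linarith
      positivity
    linarith
  have h := hanti (mem_Ioi.2 hα) (mem_Ioi.2 one_pos) hα1
  simp only [sub_self, mul_zero, add_zero, mul_one, sub_add_cancel, Real.log_one] at h
  have h2 : Real.log (α * (1 - μ + μ * α)) ≤ Real.log (α ^ (2 * μ) * (α + μ * (1 - α))) := by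
    rw [Real.log_mul hα.ne' (pos2 α hα).ne', Real.log_mul (Real.rpow_pos_of_pos hα _).ne'
      (pos1 α hα).ne', Real.log_rpow hα]
    linarith
  exact (Real.log_le_log_iff (mul_pos hα (pos2 α hα))
    (mul_pos (Real.rpow_pos_of_pos hα _) (pos1 α hα))).1 h2

/-- Divided by `A`, the difference of the two sides is affine in `A`, so it is enough to look at the
ends of the interval of admissible `A`: at `A = 1`, and at `A = 0` or where `hS` is an equality. -/
theorem sq_one_sub_le_of_one_sub_le {α u κ A : ℝ} (hα : 0 < α) (hα1 : α ≤ 1) (hu : α ≤ u)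
    (hu1 : u ≤ 1) (hκ : 0 ≤ κ) (h1 : (1 - u) ^ 2 ≤ u * κ ^ 2)
    (h2 : 1 + α - α * κ ≤ u * (1 + α + κ)) (h3 : 2 * α * (κ + α) ≤ 1 + α ^ 2)
    (hA : 0 ≤ A) (hA1 : A ≤ 1) (hS : 1 - A * u ≤ κ + α * (1 - A)) :
    (1 - A * u) ^ 2 ≤
      (1 - A) * (1 - A * α ^ 2) * (1 - A * u) + A * u * (κ + α * (1 - A)) ^ 2 := by
  -- right side minus left side is `A * (R0 + A * R1)`
  obtain ⟨R0, hR0⟩ : ∃ R0, R0 = u * (1 + (κ + α) ^ 2) - (1 + α ^ 2) := ⟨_, rfl⟩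
  obtain ⟨R1, hR1⟩ : ∃ R1, R1 = α ^ 2 + u + α ^ 2 * u - 2 * α * u * (κ + α) - u ^ 2 := ⟨_, rfl⟩
  have hone : 0 ≤ R0 + R1 := by rw [hR0, hR1]; nlinarith
  have key : 0 ≤ R0 + A * R1 := by
    -- `hS` says `1 - α - κ ≤ A * (u - α)`, a lower bound for `A` only in the second case
    rcases le_or_gt (1 - α - κ) 0 with hN | hN
    · -- `u` is eliminated by `h2`; a factor `κ + α - 1 ≥ 0` splits off
      have h0 : 0 ≤ R0 := by
        have hs : 0 ≤ κ + α - 1 := by linarith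
        have : 0 ≤ (1 + (κ + α)) * R0 := by
          have e1 : (1 + (κ + α) ^ 2) * (1 + α - α * κ)
              ≤ (1 + (κ + α) ^ 2) * (u * (1 + α + κ)) :=
            mul_le_mul_of_nonneg_left h2 (by positivity)
          have e2 : 0 ≤ (κ + α - 1) * ((κ + α) * (1 + α ^ 2 - 2 * α * (κ + α))) :=
            mul_nonneg hs (mul_nonneg (by linarith) (by linarith))
          have e3 : 0 ≤ (κ + α - 1) * (α * ((κ + α - 1) * (κ + α + 1))) := by positivity
          rw [hR0]
          nlinarith
        exact nonneg_of_mul_nonneg_right this (by linarith)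
      nlinarith
    · have hd : 0 < u - α := by
        by_contra hcon
        have : u = α := by linarith
        subst this
        nlinarith
      have hdN : 1 - α - κ ≤ A * (u - α) := by nlinarith
      have hdN' : 1 - α - κ ≤ u - α := by nlinarith
      -- the value at `A = (1 - α - κ) / (u - α)`, cleared of denominators
      have hedge : 0 ≤ (u - α) * R0 + (1 - α - κ) * R1 := by
        have : (u - α) * R0 + (1 - α - κ) * R1
            = (u - α - (1 - α - κ) * u) * (u * (1 + α + κ) - (1 + α - α * κ)) := by
          rw [hR0, hR1]; ring
        rw [this]
        apply mul_nonneg _ (by linarith)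
        nlinarith
      rcases hdN'.eq_or_lt with h | h
      · have : A = 1 := by
          rw [h] at hdN
          have := le_of_mul_le_mul_right (by linarith : 1 * (u - α) ≤ A * (u - α)) hd
          linarith
        rw [this, one_mul]; exact hone
      · have : 0 ≤ (u - α - (1 - α - κ)) * (R0 + A * R1) := by
          have : (u - α - (1 - α - κ)) * (R0 + A * R1) =
            (1 - A) * ((u - α) * R0 + (1 - α - κ) * R1)
              + (A * (u - α) - (1 - α - κ)) * (R0 + R1) := by ring
          rw [this]
          exact add_nonneg (mul_nonneg (by linarith) hedge) (mul_nonneg (by linarith) hone)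
        exact nonneg_of_mul_nonneg_right this (by linarith)
  have := mul_nonneg hA key
  rw [hR0, hR1] at this
  nlinarith

/-- The function `x ↦ log ((1 - x ^ μ) / (1 - x))` is concave and nonincreasing in `log x`; this is
its tangent at `log y`, exponentiated. -/
theorem exists_one_sub_rpow_mul_rpow_le_of_pos {μ y : ℝ} (hμ : 0 < μ) (hμ1 : μ ≤ 1) (hy : 0 < y)
    (hy1 : y < 1) : ∃ k : ℝ, 0 ≤ k ∧ ∀ x : ℝ, 0 < x → x < 1 →
      (1 - x ^ μ) * x ^ k ≤ (1 - y ^ μ) / (1 - y) * y ^ k * (1 - x) := by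
  have hlt : ∀ x : ℝ, 0 < x → x < 1 → 0 < 1 - x ^ μ := fun x h0 h1 => by
    linarith [Real.rpow_lt_one h0.le h1 hμ]
  have hi : ∀ x : ℝ, 0 < x → x < 1 → (1 - x ^ μ) * x ^ ((1 - μ) / 2) ≤ μ * (1 - x) := by
    intro x h0 h1
    have h := one_sub_rpow_mul_le hμ.le hμ1 (Real.sqrt_pos.2 h0) (Real.sqrt_le_one.2 h1.le)
    rwa [Real.sq_sqrt h0.le, Real.sqrt_eq_rpow, ← Real.rpow_mul h0.le, ← Real.rpow_mul h0.le,
      show 1 / 2 * (2 * μ) = μ by ring, show 1 / 2 * (1 - μ) = (1 - μ) / 2 by ring] at h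
  -- the derivative of `log ((1 - x) / (1 - x ^ μ))` with respect to `log x`
  set e : ℝ → ℝ := fun x => μ / (1 - x ^ μ) - 1 / (1 - x) + (1 - μ) with he
  have hpow : ∀ x : ℝ, 0 < x → HasDerivAt (fun x : ℝ => 1 - x ^ μ) (-(μ * x ^ (μ - 1))) x :=
    fun x h0 => (Real.hasDerivAt_rpow_const (Or.inl h0.ne')).const_sub 1
  have hlin : ∀ x : ℝ, HasDerivAt (fun x : ℝ => 1 - x) (-1) x :=
    fun x => (hasDerivAt_id x).const_sub 1
  have hed : ∀ x : ℝ, 0 < x → x < 1 → HasDerivAt e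
      ((0 * (1 - x ^ μ) - μ * -(μ * x ^ (μ - 1))) / (1 - x ^ μ) ^ 2
        - (0 * (1 - x) - 1 * -1) / (1 - x) ^ 2) x := by
    intro x h0 h1
    have a := (hasDerivAt_const x μ).div (hpow x h0) (hlt x h0 h1).ne'
    have b := (hasDerivAt_const x (1 : ℝ)).div (hlin x) (by linarith : (1 : ℝ) - x ≠ 0)
    exact (a.sub b).add_const (1 - μ)
  have hemono : MonotoneOn e (Ioo 0 1) := by
    refine monotoneOn_of_hasDerivWithinAt_nonneg (convex_Ioo 0 1)
      (fun x hx => (hed x hx.1 hx.2).continuousAt.continuousWithinAt)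
      (fun x hx => (hed x (interior_subset hx).1 (interior_subset hx).2).hasDerivWithinAt) ?_
    intro x hx
    obtain ⟨h0, h1⟩ := interior_subset hx
    have hp := hlt x h0 h1
    have hq : 0 < 1 - x := by linarith
    have hsq := mul_self_le_mul_self (by positivity) (hi x h0 h1)
    have e1 : x ^ ((1 - μ) / 2) * x ^ ((1 - μ) / 2) * x ^ (μ - 1) = 1 := by
      rw [← Real.rpow_add h0, ← Real.rpow_add h0]; ring_nf; exact Real.rpow_zero x
    have h2 := mul_le_mul_of_nonneg_right hsq (Real.rpow_pos_of_pos h0 (μ - 1)).le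
    have e2 : (1 - x ^ μ) * x ^ ((1 - μ) / 2) * ((1 - x ^ μ) * x ^ ((1 - μ) / 2)) * x ^ (μ - 1)
        = (1 - x ^ μ) ^ 2 := by
      linear_combination (1 - x ^ μ) ^ 2 * e1
    rw [e2] at h2
    rw [sub_nonneg, div_le_div_iff₀ (by positivity) (by positivity)]
    linarith
  have hpos : ∀ x : ℝ, 0 < x → x < 1 → 0 ≤ e x := by
    intro x h0 h1
    have hp := hlt x h0 h1
    have hq : 0 < 1 - x := by linarith
    have h2 : (1 - x ^ μ) * x ^ (1 - μ) ≤ μ * (1 - x) := by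
      refine le_trans (mul_le_mul_of_nonneg_left ?_ hp.le) (hi x h0 h1)
      exact Real.rpow_le_rpow_of_exponent_ge h0 h1.le (by linarith)
    have h3 := mul_le_mul_of_nonneg_right h2 (Real.rpow_pos_of_pos h0 μ).le
    have e1 : x ^ (1 - μ) * x ^ μ = x := by
      rw [← Real.rpow_add h0]; simp
    rw [mul_assoc, e1] at h3
    have : e x = (μ * (1 - x) * x ^ μ - (1 - x ^ μ) * x) / ((1 - x ^ μ) * (1 - x)) := by
      simp only [he]
      field_simp
      ring
    rw [this]
    exact div_nonneg (by linarith) (by positivity)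
  set H : ℝ → ℝ := fun x => Real.log (1 - x ^ μ) - Real.log (1 - x) + e y * Real.log x with hH
  have hHd : ∀ x : ℝ, 0 < x → x < 1 → HasDerivAt H ((e y - e x) / x) x := by
    intro x h0 h1
    have hp := hlt x h0 h1
    have hq : 0 < 1 - x := by linarith
    have := (((hpow x h0).log hp.ne').sub ((hlin x).log hq.ne')).add
      ((Real.hasDerivAt_log h0.ne').const_mul (e y))
    have e1 : x ^ (μ - 1) = x ^ μ / x := by rw [Real.rpow_sub h0, Real.rpow_one]
    have e2 : -(μ * x ^ (μ - 1)) / (1 - x ^ μ) - -1 / (1 - x) + e y * x⁻¹ = (e y - e x) / x := by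
      rw [e1]
      simp only [he]
      field_simp
      ring
    rw [e2] at this
    exact this
  have hmax : ∀ x : ℝ, 0 < x → x < 1 → H x ≤ H y := by
    intro x h0 h1
    rcases le_total x y with hxy | hxy
    · have hsub : ∀ z ∈ Icc x y, 0 < z ∧ z < 1 := fun z hz =>
        ⟨by linarith [hz.1], by linarith [hz.2]⟩
      refine monotoneOn_of_hasDerivWithinAt_nonneg (convex_Icc x y)
        (fun z hz => (hHd z (hsub z hz).1 (hsub z hz).2).continuousAt.continuousWithinAt)
        (fun z hz => (hHd z (hsub z (interior_subset hz)).1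
          (hsub z (interior_subset hz)).2).hasDerivWithinAt) ?_ (left_mem_Icc.2 hxy)
        (right_mem_Icc.2 hxy) hxy
      intro z hz
      have hz' := interior_subset hz
      exact div_nonneg (sub_nonneg.2 (hemono (hsub z hz') ⟨hy, hy1⟩ hz'.2)) (hsub z hz').1.le
    · have hsub : ∀ z ∈ Icc y x, 0 < z ∧ z < 1 := fun z hz =>
        ⟨by linarith [hz.1], by linarith [hz.2]⟩
      refine antitoneOn_of_hasDerivWithinAt_nonpos (convex_Icc y x)
        (fun z hz => (hHd z (hsub z hz).1 (hsub z hz).2).continuousAt.continuousWithinAt)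
        (fun z hz => (hHd z (hsub z (interior_subset hz)).1
          (hsub z (interior_subset hz)).2).hasDerivWithinAt) ?_ (left_mem_Icc.2 hxy)
        (right_mem_Icc.2 hxy) hxy
      intro z hz
      have hz' := interior_subset hz
      exact div_nonpos_of_nonpos_of_nonneg
        (sub_nonpos.2 (hemono ⟨hy, hy1⟩ (hsub z hz') hz'.1)) (hsub z hz').1.le
  have hexp : ∀ x : ℝ, 0 < x → x < 1 → Real.exp (H x) = (1 - x ^ μ) / (1 - x) * x ^ e y := by
    intro x h0 h1
    rw [hH, Real.exp_add, Real.exp_sub, Real.exp_log (hlt x h0 h1),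
      Real.exp_log (by linarith), Real.rpow_def_of_pos h0 (e y), mul_comm (e y)]
  refine ⟨e y, hpos y hy hy1, fun x h0 h1 => ?_⟩
  have h := Real.exp_le_exp.2 (hmax x h0 h1)
  rw [hexp x h0 h1, hexp y hy hy1] at h
  have hq : 0 < 1 - x := by linarith
  calc (1 - x ^ μ) * x ^ e y = (1 - x ^ μ) / (1 - x) * x ^ e y * (1 - x) := by field_simp
    _ ≤ _ := mul_le_mul_of_nonneg_right h hq.le

/-- For `p = 0` the exponent is `k = 0`, so that the value `0 ^ 0 = 1` is the intended one. -/
theorem exists_one_sub_rpow_mul_rpow_le {μ p : ℝ} (hμ : 0 < μ) (hμ1 : μ ≤ 1) (hp : 0 ≤ p)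
    (hp1 : p < 1) : ∃ k : ℝ, 0 ≤ k ∧ 0 < p ^ k ∧ ∀ r : ℝ, 0 ≤ r → r < 1 →
      (1 - r ^ (2 * μ)) * r ^ k ≤ (1 - p ^ (2 * μ)) / (1 - p ^ 2) * p ^ k * (1 - r ^ 2) := by
  rcases hp.eq_or_lt with rfl | hp0
  · refine ⟨0, le_rfl, by simp, fun r hr hr1 => ?_⟩
    have : r ^ 2 ≤ r ^ (2 * μ) := by
      rcases hr.eq_or_lt with rfl | hr0
      · simp [Real.zero_rpow (by positivity : 2 * μ ≠ 0)]
      · rw [← Real.rpow_natCast]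
        exact Real.rpow_le_rpow_of_exponent_ge hr0 hr1.le (by push_cast; linarith)
    simp [Real.zero_rpow (by positivity : 2 * μ ≠ 0)]
    linarith
  · obtain ⟨k, hk, h⟩ := exists_one_sub_rpow_mul_rpow_le_of_pos hμ hμ1 (by positivity : 0 < p ^ 2)
      (by nlinarith)
    have conv : ∀ x : ℝ, 0 ≤ x → ∀ s : ℝ, (x ^ 2) ^ s = x ^ (2 * s) := fun x hx s => by
      rw [← Real.rpow_natCast, ← Real.rpow_mul hx]; simp
    refine ⟨2 * k, by positivity, by positivity, fun r hr hr1 => ?_⟩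
    rcases hr.eq_or_lt with rfl | hr0
    · have h1 : 0 ≤ 1 - p ^ (2 * μ) := by
        linarith [Real.rpow_le_one hp0.le hp1.le (by positivity : 0 ≤ 2 * μ)]
      have h2 : 0 < 1 - p ^ 2 := by nlinarith
      rcases hk.eq_or_lt with rfl | hk0
      · -- let `r → 0` in the inequality for positive `r`
        have hlim : Filter.Tendsto (fun x : ℝ => (1 - x ^ μ) - (1 - (p ^ 2) ^ μ) / (1 - p ^ 2) *
            (1 - x)) (nhdsWithin 0 (Ioi 0))
            (nhds ((1 - (0 : ℝ) ^ μ) - (1 - (p ^ 2) ^ μ) / (1 - p ^ 2) * (1 - 0))) := by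
          apply Filter.Tendsto.mono_left _ nhdsWithin_le_nhds
          have : Continuous fun x : ℝ =>
              (1 - x ^ μ) - (1 - (p ^ 2) ^ μ) / (1 - p ^ 2) * (1 - x) := by
            have := Real.continuous_rpow_const hμ.le
            fun_prop
          exact this.tendsto 0
        have := le_of_tendsto hlim (b := 0) (by
          filter_upwards [Ioo_mem_nhdsGT (zero_lt_one' ℝ)] with x hx
          have := h x hx.1 hx.2
          simp only [Real.rpow_zero, mul_one] at this
          linarith)
        rw [conv p hp0.le] at this
        simp [Real.zero_rpow (by positivity : 2 * μ ≠ 0), Real.zero_rpow hμ.ne'] at this ⊢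
        linarith
      · rw [Real.zero_rpow (by positivity : 2 * k ≠ 0), mul_zero]
        have : 0 ≤ p ^ (2 * k) := by positivity
        have : 0 ≤ (1 - p ^ (2 * μ)) / (1 - p ^ 2) := div_nonneg h1 h2.le
        simp only [ne_eq, OfNat.ofNat_ne_zero, not_false_eq_true, zero_pow, sub_zero, mul_one]
        positivity
    · have := h (r ^ 2) (by positivity) (by nlinarith)
      simpa only [conv r hr, conv p hp0.le] using this

/-! ### Discs in the egg domain: the Schwarz lemma -/

/-- The maximum principle for the log-subharmonic function `‖A‖ ‖B‖ ^ k`, where `k ≥ 0` is real. -/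
theorem norm_mul_rpow_le_of_forall_sphere {A B : ℂ → ℂ} {k M : ℝ}
    (hA : DiffContOnCl ℂ A (Metric.ball 0 1)) (hB : DiffContOnCl ℂ B (Metric.ball 0 1))
    (hk : 0 ≤ k) (hB1 : ∀ z ∈ Metric.sphere (0 : ℂ) 1, ‖B z‖ ≤ 1)
    (hM : ∀ z ∈ Metric.sphere (0 : ℂ) 1, ‖A z‖ * ‖B z‖ ^ k ≤ M) (h0 : 0 < ‖B 0‖ ^ k) :
    ‖A 0‖ * ‖B 0‖ ^ k ≤ M := by
  have hfr : frontier (Metric.ball (0 : ℂ) 1) = Metric.sphere 0 1 := frontier_ball 0 one_ne_zero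
  have hmem : (0 : ℂ) ∈ closure (Metric.ball (0 : ℂ) 1) := subset_closure (by simp)
  have hmax : ∀ {F : ℂ → ℂ} {C : ℝ}, DiffContOnCl ℂ F (Metric.ball 0 1) →
      (∀ z ∈ Metric.sphere (0 : ℂ) 1, ‖F z‖ ≤ C) → ‖F 0‖ ≤ C := fun hF hC =>
    Complex.norm_le_of_forall_mem_frontier_norm_le Metric.isBounded_ball hF
      (by rw [hfr]; exact hC) hmem
  have hM0 : 0 ≤ M := le_trans (by positivity) (hM 1 (by simp))
  rcases hk.eq_or_lt with rfl | hk0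
  · simp only [Real.rpow_zero, mul_one] at hM ⊢
    exact hmax hA hM
  have hBpos : 0 < ‖B 0‖ := by
    rcases (norm_nonneg (B 0)).eq_or_lt with h | h
    · rw [← h, Real.zero_rpow hk0.ne'] at h0
      exact absurd h0 (lt_irrefl 0)
    · exact h
  have hB01 : ‖B 0‖ ≤ 1 := hmax hB hB1
  -- round `k` up to a rational number with denominator `n + 1`
  have hn : ∀ n : ℕ, ‖A 0‖ * ‖B 0‖ ^ (k + 1 / ((n : ℝ) + 1)) ≤ M := by
    intro n
    have hpow : DiffContOnCl ℂ (fun z => A z ^ (n + 1) * B z ^ ⌈k * (n + 1)⌉₊)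
        (Metric.ball 0 1) :=
      ⟨(hA.1.pow _).mul (hB.1.pow _), (hA.2.pow _).mul (hB.2.pow _)⟩
    have h1 := hmax (C := M ^ (n + 1)) hpow (by
      intro z hz
      rw [norm_mul, norm_pow, norm_pow]
      calc ‖A z‖ ^ (n + 1) * ‖B z‖ ^ ⌈k * (n + 1)⌉₊
          ≤ ‖A z‖ ^ (n + 1) * (‖B z‖ ^ k) ^ (n + 1) := by
            gcongr
            rw [← Real.rpow_natCast, ← Real.rpow_natCast, ← Real.rpow_mul (norm_nonneg _)]
            refine Real.rpow_le_rpow_of_exponent_ge' (norm_nonneg _) (hB1 z hz) (by positivity) ?_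
            push_cast
            exact Nat.le_ceil _
        _ = (‖A z‖ * ‖B z‖ ^ k) ^ (n + 1) := by ring
        _ ≤ M ^ (n + 1) := by gcongr; exact hM z hz)
    rw [norm_mul, norm_pow, norm_pow] at h1
    rw [← pow_le_pow_iff_left₀ (by positivity) hM0 (Nat.succ_ne_zero n)]
    refine le_trans ?_ h1
    rw [mul_pow]
    gcongr
    rw [← Real.rpow_natCast, ← Real.rpow_natCast, ← Real.rpow_mul (norm_nonneg _)]
    refine Real.rpow_le_rpow_of_exponent_ge hBpos hB01 ?_
    have := (Nat.ceil_lt_add_one (by positivity : 0 ≤ k * ((n : ℝ) + 1))).le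
    have e : (k + 1 / ((n : ℝ) + 1)) * ((n + 1 : ℕ) : ℝ) = k * (n + 1) + 1 := by
      push_cast
      field_simp
    rw [Nat.succ_eq_add_one, e]
    exact this
  have hlim : Filter.Tendsto (fun n : ℕ => ‖A 0‖ * ‖B 0‖ ^ (k + 1 / ((n : ℝ) + 1))) Filter.atTop
      (nhds (‖A 0‖ * ‖B 0‖ ^ (k + 0))) :=
    (((Real.continuous_const_rpow hBpos.ne').tendsto _).comp
      (tendsto_const_nhds.add tendsto_one_div_add_atTop_nhds_zero_nat)).const_mul _
  rw [add_zero] at hlim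
  exact le_of_tendsto' hlim hn

theorem norm_one_sub_mul_sq_sub (p : ℝ) (w : ℂ) :
    ‖1 - (p : ℂ) * w‖ ^ 2 - ‖w - p‖ ^ 2 = (1 - p ^ 2) * (1 - ‖w‖ ^ 2) := by
  simp only [Complex.sq_norm, Complex.normSq_apply, Complex.sub_re, Complex.sub_im, Complex.mul_re,
    Complex.mul_im, Complex.ofReal_re, Complex.ofReal_im, Complex.one_re, Complex.one_im]
  ring

/-- The concave function `1 - ‖w‖ ^ 2` lies below its tangent at `t`, and `1 - X ≤ exp (-X)`. -/
theorem one_sub_norm_sq_le_mul_exp {t w : ℂ} (ht : ‖t‖ < 1) :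
    1 - ‖w‖ ^ 2 ≤ (1 - ‖t‖ ^ 2) *
      Real.exp (-(2 / (1 - ‖t‖ ^ 2) * (starRingEnd ℂ t * (w - t)).re)) := by
  have hT : 0 < 1 - ‖t‖ ^ 2 := by nlinarith [norm_nonneg t]
  have h1 : 1 - ‖w‖ ^ 2 ≤ 1 - ‖t‖ ^ 2 - 2 * (starRingEnd ℂ t * (w - t)).re := by
    have : 0 ≤ ‖w - t‖ ^ 2 := by positivity
    simp only [Complex.sq_norm, Complex.normSq_apply, Complex.mul_re, Complex.conj_re,
      Complex.conj_im, Complex.sub_re, Complex.sub_im] at this ⊢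
    nlinarith
  refine h1.trans ?_
  have h2 := Real.add_one_le_exp (-(2 / (1 - ‖t‖ ^ 2) * (starRingEnd ℂ t * (w - t)).re))
  have h3 := mul_le_mul_of_nonneg_left h2 hT.le
  refine le_trans (le_of_eq ?_) h3
  field_simp
  ring

/-- The Schwarz lemma for discs in the egg domain centred at `(0, p)`. -/
theorem norm_deriv_sq_div_add_le_one {μ p R : ℝ} (hμ : 0 < μ) (hμ1 : μ ≤ 1) (hp : 0 ≤ p)
    (hp1 : p < 1) (hR : 1 < R) {φ₁ φ₂ : ℂ → ℂ} (h₁ : DifferentiableOn ℂ φ₁ (Metric.ball 0 R))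
    (h₂ : DifferentiableOn ℂ φ₂ (Metric.ball 0 R))
    (hφ : ∀ z ∈ Metric.ball (0 : ℂ) R, ‖φ₁ z‖ ^ 2 + ‖φ₂ z‖ ^ (2 * μ) < 1)
    (h₁0 : φ₁ 0 = 0) (h₂0 : φ₂ 0 = p) :
    ‖deriv φ₁ 0‖ ^ 2 / (1 - p ^ (2 * μ)) + ‖deriv φ₂ 0‖ ^ 2 / (1 - p ^ 2) ^ 2 ≤ 1 := by
  have hR0 : (0 : ℂ) ∈ Metric.ball (0 : ℂ) R := by simp; linarith
  have hnhds : Metric.ball (0 : ℂ) R ∈ nhds (0 : ℂ) := Metric.isOpen_ball.mem_nhds hR0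
  have hcl : closure (Metric.ball (0 : ℂ) 1) ⊆ Metric.ball 0 R := by
    rw [closure_ball _ one_ne_zero]
    exact Metric.closedBall_subset_ball hR
  have hsph : ∀ z ∈ Metric.sphere (0 : ℂ) 1, z ∈ Metric.ball (0 : ℂ) R ∧ ‖z‖ = 1 := by
    intro z hz
    have : ‖z‖ = 1 := by simpa using hz
    exact ⟨by simp [this, hR], this⟩
  have hφ₂1 : ∀ z ∈ Metric.ball (0 : ℂ) R, ‖φ₂ z‖ < 1 := by
    intro z hz
    have : ‖φ₂ z‖ ^ (2 * μ) < 1 := by nlinarith [hφ z hz, sq_nonneg ‖φ₁ z‖]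
    by_contra hcon
    exact absurd (Real.one_le_rpow (not_lt.1 hcon) (by positivity : 0 ≤ 2 * μ)) (not_le.2 this)
  have hden : ∀ z ∈ Metric.ball (0 : ℂ) R, 1 - (p : ℂ) * φ₂ z ≠ 0 := by
    intro z hz h
    have h1 : ‖(p : ℂ) * φ₂ z‖ = 1 := by rw [← sub_eq_zero.1 h, norm_one]
    rw [norm_mul, Complex.norm_real, Real.norm_of_nonneg hp] at h1
    nlinarith [hφ₂1 z hz, norm_nonneg (φ₂ z)]
  have hp2 : 0 < 1 - p ^ 2 := by nlinarith
  have hq2 : 0 < 1 - p ^ (2 * μ) := by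
    linarith [Real.rpow_lt_one hp hp1 (by positivity : 0 < 2 * μ)]
  obtain ⟨k, hk, hpk, hkr⟩ := exists_one_sub_rpow_mul_rpow_le hμ hμ1 hp hp1
  -- `φ₂` followed by the automorphism of the unit disc that moves `p` to `0`
  set f : ℂ → ℂ := fun z => (φ₂ z - p) / (1 - p * φ₂ z) with hf
  have hfd : DifferentiableOn ℂ f (Metric.ball 0 R) :=
    (h₂.sub_const _).div ((h₂.const_mul _).const_sub _) hden
  have hf0 : f 0 = 0 := by simp [hf, h₂0]
  have hfderiv : deriv f 0 = deriv φ₂ 0 / (1 - (p : ℂ) ^ 2) := by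
    have hd := (h₂.differentiableAt hnhds).hasDerivAt
    have := (hd.sub_const (p : ℂ)).div ((hd.const_mul (p : ℂ)).const_sub 1) (hden 0 hR0)
    have h := this.deriv
    have hne := hden 0 hR0
    rw [h₂0] at h hne
    have hne' : 1 - (p : ℂ) ^ 2 ≠ 0 := by rwa [sq]
    refine h.trans ?_
    rw [sub_self, zero_mul, sub_zero, ← sq]
    field_simp
  set ψ := dslope φ₁ 0 with hψ
  set g := dslope f 0 with hg
  have hψd : DifferentiableOn ℂ ψ (Metric.ball 0 R) := (Complex.differentiableOn_dslope hnhds).2 h₁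
  have hgd : DifferentiableOn ℂ g (Metric.ball 0 R) := (Complex.differentiableOn_dslope hnhds).2 hfd
  have hψn : ∀ z ∈ Metric.sphere (0 : ℂ) 1, ‖ψ z‖ = ‖φ₁ z‖ := by
    intro z hz
    have := sub_smul_dslope φ₁ 0 z
    rw [h₁0, sub_zero, sub_zero] at this
    rw [← this, norm_smul, (hsph z hz).2, one_mul]
  have hgn : ∀ z ∈ Metric.sphere (0 : ℂ) 1, ‖g z‖ = ‖f z‖ := by
    intro z hz
    have := sub_smul_dslope f 0 z
    rw [hf0, sub_zero, sub_zero] at this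
    rw [← this, norm_smul, (hsph z hz).2, one_mul]
  have hfsq : ∀ z ∈ Metric.ball (0 : ℂ) R,
      1 - ‖f z‖ ^ 2 = (1 - p ^ 2) * (1 - ‖φ₂ z‖ ^ 2) / ‖1 - (p : ℂ) * φ₂ z‖ ^ 2 := by
    intro z hz
    have : 0 < ‖1 - (p : ℂ) * φ₂ z‖ := norm_pos_iff.2 (hden z hz)
    rw [← norm_one_sub_mul_sq_sub, hf, norm_div, div_pow, sub_div, div_self (by positivity)]
  set t := g 0 with ht
  have ht1 : ‖t‖ < 1 := by
    obtain ⟨z, hz, hzmax⟩ := (isCompact_sphere (0 : ℂ) 1).exists_isMaxOn ⟨1, by simp⟩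
      (hgd.continuousOn.norm.mono fun z hz => (hsph z hz).1)
    have h1 : ‖t‖ ≤ ‖g z‖ := Complex.norm_le_of_forall_mem_frontier_norm_le Metric.isBounded_ball
      (hgd.mono hcl).diffContOnCl
      (by rw [frontier_ball _ one_ne_zero]; exact fun w hw => hzmax hw) (subset_closure (by simp))
    refine h1.trans_lt ?_
    have hzR := (hsph z hz).1
    have h2 := hfsq z hzR
    have h3 : 0 < ‖1 - (p : ℂ) * φ₂ z‖ := norm_pos_iff.2 (hden z hzR)
    have h4 : 0 < 1 - ‖φ₂ z‖ ^ 2 := by nlinarith [hφ₂1 z hzR, norm_nonneg (φ₂ z)]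
    have h5 : 0 < 1 - ‖f z‖ ^ 2 := by rw [h2]; positivity
    rw [hgn z hz]
    nlinarith [norm_nonneg (f z)]
  have hT : 0 < 1 - ‖t‖ ^ 2 := by nlinarith [norm_nonneg t]
  -- the exponential turns the factor `1 - ‖g z‖ ^ 2` on the circle into its value at `0`
  set A : ℂ → ℂ := fun z => (ψ z / (1 - p * φ₂ z)) ^ 2 *
    Complex.exp (((2 / (1 - ‖t‖ ^ 2) : ℝ) : ℂ) * (starRingEnd ℂ t * (g z - t))) with hA
  have hAd : DifferentiableOn ℂ A (Metric.ball 0 R) :=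
    ((hψd.div ((h₂.const_mul _).const_sub _) hden).pow 2).mul
      (((hgd.sub_const _).const_mul _).const_mul _).cexp
  have hmax := norm_mul_rpow_le_of_forall_sphere (A := A) (B := φ₂) (k := k)
    (M := (1 - p ^ (2 * μ)) / (1 - p ^ 2) * p ^ k / (1 - p ^ 2) * (1 - ‖t‖ ^ 2))
    (hAd.mono hcl).diffContOnCl (h₂.mono hcl).diffContOnCl hk
    (fun z hz => (hφ₂1 z (hsph z hz).1).le) (by
      intro z hz
      obtain ⟨hzR, hz1⟩ := hsph z hz
      have h3 : 0 < ‖1 - (p : ℂ) * φ₂ z‖ := norm_pos_iff.2 (hden z hzR)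
      have h4 := hkr ‖φ₂ z‖ (norm_nonneg _) (hφ₂1 z hzR)
      have h5 : ‖ψ z‖ ^ 2 ≤ 1 - ‖φ₂ z‖ ^ (2 * μ) := by
        rw [hψn z hz]; linarith [hφ z hzR]
      have h6 := one_sub_norm_sq_le_mul_exp (w := g z) ht1
      rw [hgn z hz, hfsq z hzR] at h6
      set X := 2 / (1 - ‖t‖ ^ 2) * (starRingEnd ℂ t * (g z - t)).re with hX
      have h7 : ‖A z‖ = ‖ψ z‖ ^ 2 / ‖1 - (p : ℂ) * φ₂ z‖ ^ 2 * Real.exp X := by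
        rw [hA, norm_mul, norm_pow, norm_div, Complex.norm_exp, Complex.re_ofReal_mul, div_pow]
      have h8 : ‖ψ z‖ ^ 2 * ‖φ₂ z‖ ^ k ≤
          (1 - p ^ (2 * μ)) / (1 - p ^ 2) * p ^ k * (1 - ‖φ₂ z‖ ^ 2) :=
        (mul_le_mul_of_nonneg_right h5 (by positivity)).trans h4
      have hc : 0 ≤ (1 - p ^ (2 * μ)) / (1 - p ^ 2) * p ^ k / (1 - p ^ 2) := by positivity
      calc ‖A z‖ * ‖φ₂ z‖ ^ k
          = ‖ψ z‖ ^ 2 * ‖φ₂ z‖ ^ k / ‖1 - (p : ℂ) * φ₂ z‖ ^ 2 * Real.exp X := by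
            rw [h7]; ring
        _ ≤ (1 - p ^ (2 * μ)) / (1 - p ^ 2) * p ^ k * (1 - ‖φ₂ z‖ ^ 2) /
              ‖1 - (p : ℂ) * φ₂ z‖ ^ 2 * Real.exp X := by gcongr
        _ = (1 - p ^ (2 * μ)) / (1 - p ^ 2) * p ^ k / (1 - p ^ 2) *
            ((1 - p ^ 2) * (1 - ‖φ₂ z‖ ^ 2) / ‖1 - (p : ℂ) * φ₂ z‖ ^ 2) * Real.exp X := by
            field_simp
        _ ≤ (1 - p ^ (2 * μ)) / (1 - p ^ 2) * p ^ k / (1 - p ^ 2) *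
            ((1 - ‖t‖ ^ 2) * Real.exp (-X)) * Real.exp X := by gcongr
        _ = _ := by
            rw [mul_assoc, mul_assoc (1 - ‖t‖ ^ 2), ← Real.exp_add, neg_add_cancel, Real.exp_zero,
              mul_one])
    (by rw [h₂0, Complex.norm_real, Real.norm_of_nonneg hp]; exact hpk)
  have hA0 : ‖A 0‖ = ‖deriv φ₁ 0‖ ^ 2 / (1 - p ^ 2) ^ 2 := by
    have e1 : ‖1 - (p : ℂ) * p‖ = 1 - p ^ 2 := by
      rw [show 1 - (p : ℂ) * p = ((1 - p ^ 2 : ℝ) : ℂ) by push_cast; ring, Complex.norm_real,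
        Real.norm_of_nonneg hp2.le]
    rw [hA, norm_mul, norm_pow, norm_div, h₂0, e1, ← ht, hψ, dslope_same]
    simp [div_pow]
  have ht' : ‖t‖ ^ 2 = ‖deriv φ₂ 0‖ ^ 2 / (1 - p ^ 2) ^ 2 := by
    have e1 : ‖1 - (p : ℂ) ^ 2‖ = 1 - p ^ 2 := by
      rw [show 1 - (p : ℂ) ^ 2 = ((1 - p ^ 2 : ℝ) : ℂ) by push_cast; ring, Complex.norm_real,
        Real.norm_of_nonneg hp2.le]
    rw [ht, hg, dslope_same, hfderiv, norm_div, e1, div_pow]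
  rw [hA0, h₂0, Complex.norm_real, Real.norm_of_nonneg hp] at hmax
  rw [← ht']
  have h9 : ‖deriv φ₁ 0‖ ^ 2 ≤ (1 - p ^ (2 * μ)) * (1 - ‖t‖ ^ 2) := by
    have e : (1 - p ^ (2 * μ)) / (1 - p ^ 2) * p ^ k / (1 - p ^ 2) * (1 - ‖t‖ ^ 2)
        = (1 - p ^ (2 * μ)) * (1 - ‖t‖ ^ 2) / (1 - p ^ 2) ^ 2 * p ^ k := by
      field_simp
    rw [e] at hmax
    have := le_of_mul_le_mul_right hmax hpk
    rwa [div_le_div_iff_of_pos_right (by positivity)] at this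
  have h10 : ‖deriv φ₁ 0‖ ^ 2 / (1 - p ^ (2 * μ)) ≤ 1 - ‖t‖ ^ 2 := by
    rw [div_le_iff₀ hq2]; linarith
  linarith

theorem kobayashiIndicatrix_eggDomain_subset {μ p : ℝ} (hμ : 0 < μ) (hμ1 : μ ≤ 1) (hp : 0 ≤ p)
    (hp1 : p < 1) : kobayashiIndicatrix (eggDomain μ) ((0 : ℂ), (p : ℂ)) ⊆
      {v | ‖v.1‖ ^ 2 / (1 - p ^ (2 * μ)) + ‖v.2‖ ^ 2 / (1 - p ^ 2) ^ 2 < 1} := by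
  intro v hv
  simp only [kobayashiIndicatrix, kobayashiMetric, mem_ofPred_eq, iInf_lt_iff] at hv
  obtain ⟨α, ⟨φ, hφd, hφm, hφ0, hφv⟩, hα⟩ := hv
  have hα1 : ‖α‖ < 1 := by
    rwa [← ofReal_norm, ENNReal.ofReal_lt_one] at hα
  -- replacing `φ` by `ζ ↦ φ (s ζ)` makes the disc holomorphic past the unit circle
  obtain ⟨s, hs0, hs1⟩ := exists_between hα1
  have hspos : 0 < s := (norm_nonneg α).trans_lt hs0
  have hmaps : MapsTo (fun z : ℂ => (s : ℂ) * z) (Metric.ball 0 (1 / s)) (Metric.ball 0 1) := by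
    intro z hz
    rw [mem_ball_zero_iff] at hz ⊢
    rw [norm_mul, Complex.norm_real, Real.norm_of_nonneg hspos.le]
    rw [lt_div_iff₀ hspos] at hz
    linarith
  have hd : DifferentiableOn ℂ (fun z => φ (s * z)) (Metric.ball 0 (1 / s)) :=
    hφd.comp (differentiableOn_id.const_mul _) hmaps
  have hφ' : HasDerivAt φ (deriv φ 0) 0 :=
    (hφd.differentiableAt (Metric.isOpen_ball.mem_nhds (by simp))).hasDerivAt
  have hφs : HasDerivAt (fun z : ℂ => φ (s * z)) ((s : ℂ) • deriv φ 0) 0 := by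
    have h1 : HasDerivAt (fun z : ℂ => (s : ℂ) * z) (s : ℂ) 0 := by
      simpa using (hasDerivAt_id (0 : ℂ)).const_mul (s : ℂ)
    exact HasDerivAt.scomp (0 : ℂ) (by simpa using hφ') h1
  have hfst : deriv (fun z : ℂ => (φ (s * z)).1) 0 = s * (deriv φ 0).1 :=
    ((ContinuousLinearMap.fst ℂ ℂ ℂ).hasFDerivAt.comp_hasDerivAt (0 : ℂ) hφs).deriv
  have hsnd : deriv (fun z : ℂ => (φ (s * z)).2) 0 = s * (deriv φ 0).2 :=
    ((ContinuousLinearMap.snd ℂ ℂ ℂ).hasFDerivAt.comp_hasDerivAt (0 : ℂ) hφs).deriv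
  have h := norm_deriv_sq_div_add_le_one hμ hμ1 hp hp1 (R := 1 / s)
    (by rw [lt_div_iff₀ hspos]; linarith) hd.fst hd.snd
    (fun z hz => hφm (hmaps hz)) (by simp [hφ0]) (by simp [hφ0])
  rw [hfst, hsnd, norm_mul, norm_mul, Complex.norm_real, Real.norm_of_nonneg hspos.le] at h
  have hp2 : 0 < 1 - p ^ 2 := by nlinarith
  have hq2 : 0 < 1 - p ^ (2 * μ) := by
    linarith [Real.rpow_lt_one hp hp1 (by positivity : 0 < 2 * μ)]
  rw [mem_ofPred_eq, ← hφv]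
  simp only [Prod.smul_fst, Prod.smul_snd, norm_smul]
  set N := ‖(deriv φ 0).1‖ ^ 2 / (1 - p ^ (2 * μ)) + ‖(deriv φ 0).2‖ ^ 2 / (1 - p ^ 2) ^ 2 with hN
  have e1 : (‖α‖ * ‖(deriv φ 0).1‖) ^ 2 / (1 - p ^ (2 * μ)) +
      (‖α‖ * ‖(deriv φ 0).2‖) ^ 2 / (1 - p ^ 2) ^ 2 = ‖α‖ ^ 2 * N := by rw [hN]; ring
  have e2 : (s * ‖(deriv φ 0).1‖) ^ 2 / (1 - p ^ (2 * μ)) +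
      (s * ‖(deriv φ 0).2‖) ^ 2 / (1 - p ^ 2) ^ 2 = s ^ 2 * N := by rw [hN]; ring
  rw [e1]
  rw [e2] at h
  have hN0 : 0 ≤ N := by positivity
  have hsq : ‖α‖ ^ 2 < s ^ 2 := by gcongr
  rcases hN0.eq_or_lt with h0 | h0
  · rw [← h0]; simp
  · exact (mul_lt_mul_of_pos_right hsq h0).trans_le h

/-! ### Discs in the egg domain: construction -/

/-- If `‖c‖ ^ 2 = (1 - A) (1 - A α ^ 2)`, the two sides differ by `(1 - A) (1 - ‖ζ‖ ^ 2)`. -/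
theorem norm_sq_mul_add_lt {A α : ℝ} {c ζ : ℂ} (hA1 : A < 1)
    (hc : ‖c‖ ^ 2 ≤ (1 - A) * (1 - A * α ^ 2)) (hζ : ‖ζ‖ < 1) :
    ‖c‖ ^ 2 * ‖ζ‖ ^ 2 + A * ‖1 - (α : ℂ) * ζ‖ ^ 2 < ‖1 - ((A * α : ℝ) : ℂ) * ζ‖ ^ 2 := by
  have hid : ‖1 - ((A * α : ℝ) : ℂ) * ζ‖ ^ 2 - A * ‖1 - (α : ℂ) * ζ‖ ^ 2
      = (1 - A) * (1 - A * α ^ 2 * ‖ζ‖ ^ 2) := by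
    simp only [Complex.sq_norm, Complex.normSq_apply, Complex.sub_re, Complex.sub_im,
      Complex.mul_re, Complex.mul_im, Complex.ofReal_re, Complex.ofReal_im, Complex.one_re,
      Complex.one_im]
    ring
  have h1 := mul_le_mul_of_nonneg_right hc (sq_nonneg ‖ζ‖)
  have h2 : 0 < (1 - A) * (1 - ‖ζ‖ ^ 2) :=
    mul_pos (by linarith) (by nlinarith [norm_nonneg ζ])
  nlinarith

theorem one_sub_mul_mem_slitPlane {α : ℝ} {ζ : ℂ} (hα : 0 ≤ α) (hα1 : α ≤ 1) (hζ : ‖ζ‖ < 1) :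
    1 - (α : ℂ) * ζ ∈ Complex.slitPlane := by
  left
  have h1 : (α * ζ.re) < 1 := by
    have := (abs_le.1 (Complex.abs_re_le_norm ζ)).2
    rcases hα.eq_or_lt with rfl | h
    · simp
    · nlinarith
  simpa using h1

/-- The disc `ζ ↦ (c ζ / (1 - γ ζ), a m(ζ) ((1 - α ζ) / (1 - γ ζ)) ^ (1 / μ))` with `A = a ^ (2 μ)`
and `γ = A α` lies in the egg domain. -/
theorem kobayashiMetric_eggDomain_le {μ a α : ℝ} {m : ℂ → ℂ} {c l : ℂ} (hμ : 0 < μ) (ha : 0 ≤ a)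
    (ha1 : a < 1) (hα : 0 ≤ α) (hα1 : α ≤ 1) (hm : DifferentiableOn ℂ m (Metric.ball 0 1))
    (hm1 : ∀ ζ ∈ Metric.ball (0 : ℂ) 1, ‖m ζ‖ ≤ 1)
    (hc : ‖c‖ ^ 2 ≤ (1 - a ^ (2 * μ)) * (1 - a ^ (2 * μ) * α ^ 2)) :
    kobayashiMetric (eggDomain μ) ((0 : ℂ), (a : ℂ) * m 0)
      (l * c, l * (a * (deriv m 0 - m 0 * (α * (1 - a ^ (2 * μ)) / μ : ℝ)))) ≤ ‖l‖ₑ := by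
  set A := a ^ (2 * μ) with hA
  have hA0 : 0 ≤ A := Real.rpow_nonneg ha _
  have hA1 : A < 1 := Real.rpow_lt_one ha ha1 (by positivity)
  set γ := A * α with hγ
  have hγ0 : 0 ≤ γ := by positivity
  have hγ1 : γ ≤ 1 := mul_le_one₀ hA1.le hα hα1
  set r : ℂ := ((1 / μ : ℝ) : ℂ) with hr
  have hlin : ∀ (x : ℝ) (ζ : ℂ), HasDerivAt (fun ζ : ℂ => 1 - (x : ℂ) * ζ) (-(x : ℂ)) ζ := by
    intro x ζ
    simpa using ((hasDerivAt_id ζ).const_mul (x : ℂ)).const_sub 1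
  have hd₁ : DifferentiableOn ℂ (fun ζ : ℂ => c * ζ / (1 - (γ : ℂ) * ζ)) (Metric.ball 0 1) :=
    (differentiableOn_id.const_mul c).div
      (fun ζ _ => (hlin γ ζ).differentiableAt.differentiableWithinAt)
      (fun ζ hζ => Complex.slitPlane_ne_zero
        (one_sub_mul_mem_slitPlane hγ0 hγ1 (mem_ball_zero_iff.1 hζ)))
  have hd₂ : ∀ (x : ℝ) (ζ s : ℂ), 0 ≤ x → x ≤ 1 → ‖ζ‖ < 1 →
      HasDerivAt (fun ζ : ℂ => (1 - (x : ℂ) * ζ) ^ s)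
        (s * (1 - (x : ℂ) * ζ) ^ (s - 1) * -(x : ℂ)) ζ :=
    fun x ζ s h0 h1 hζ => (hlin x ζ).cpow_const (one_sub_mul_mem_slitPlane h0 h1 hζ)
  have hzero : (0 : ℂ) ∈ Metric.ball (0 : ℂ) 1 := by simp
  have hmd : HasDerivAt m (deriv m 0) 0 :=
    (hm.differentiableAt (Metric.isOpen_ball.mem_nhds hzero)).hasDerivAt
  set φ : ℂ → ℂ × ℂ := fun ζ => (c * ζ / (1 - (γ : ℂ) * ζ),
    a * (m ζ * ((1 - (α : ℂ) * ζ) ^ r * (1 - (γ : ℂ) * ζ) ^ (-r)))) with hφ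
  have hφd : HasDerivAt φ (c, a * (deriv m 0 - m 0 * (α * (1 - A) / μ : ℝ))) 0 := by
    refine HasDerivAt.prodMk ?_ ?_
    · have := ((hasDerivAt_id (0 : ℂ)).const_mul c).div (hlin γ 0) (by simp)
      refine this.congr_deriv ?_
      simp
    · have := ((hmd.mul ((hd₂ α 0 r hα hα1 (by simp)).mul
        (hd₂ γ 0 (-r) hγ0 hγ1 (by simp)))).const_mul (a : ℂ))
      refine this.congr_deriv ?_
      simp [hr, hγ]
      left
      ring
  unfold kobayashiMetric
  refine iInf₂_le l ⟨φ, ?_, ?_, ?_, ?_⟩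
  · refine DifferentiableOn.prodMk hd₁ ((hm.mul (DifferentiableOn.mul ?_ ?_)).const_mul _)
    · exact fun ζ hζ => (hd₂ α ζ r hα hα1
        (mem_ball_zero_iff.1 hζ)).differentiableAt.differentiableWithinAt
    · exact fun ζ hζ => (hd₂ γ ζ (-r) hγ0 hγ1
        (mem_ball_zero_iff.1 hζ)).differentiableAt.differentiableWithinAt
  · intro ζ hζ
    have hζ1 := mem_ball_zero_iff.1 hζ
    have hY : 0 < ‖1 - (γ : ℂ) * ζ‖ :=
      norm_pos_iff.2 (Complex.slitPlane_ne_zero (one_sub_mul_mem_slitPlane hγ0 hγ1 hζ1))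
    have hlt := norm_sq_mul_add_lt hA1 hc hζ1
    have e2 : ‖(φ ζ).2‖ ^ (2 * μ) =
        A * ‖m ζ‖ ^ (2 * μ) * ‖1 - (α : ℂ) * ζ‖ ^ 2 / ‖1 - (γ : ℂ) * ζ‖ ^ 2 := by
      simp only [hφ, norm_mul, Complex.norm_real, Real.norm_of_nonneg ha]
      rw [hr, ← Complex.ofReal_neg, Complex.norm_cpow_real, Complex.norm_cpow_real,
        Real.mul_rpow ha (by positivity), Real.mul_rpow (by positivity) (by positivity),
        Real.mul_rpow (by positivity) (by positivity), ← Real.rpow_mul (norm_nonneg _),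
        ← Real.rpow_mul (norm_nonneg _), show 1 / μ * (2 * μ) = 2 by field_simp,
        show -(1 / μ) * (2 * μ) = -2 by field_simp, Real.rpow_neg (norm_nonneg _),
        Real.rpow_two, Real.rpow_two]
      ring
    have e1 : ‖(φ ζ).1‖ ^ 2 = ‖c‖ ^ 2 * ‖ζ‖ ^ 2 / ‖1 - (γ : ℂ) * ζ‖ ^ 2 := by
      simp only [hφ, norm_mul, norm_div]
      ring
    have h3 : A * ‖m ζ‖ ^ (2 * μ) * ‖1 - (α : ℂ) * ζ‖ ^ 2 ≤ A * ‖1 - (α : ℂ) * ζ‖ ^ 2 := by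
      refine mul_le_mul_of_nonneg_right ?_ (by positivity)
      exact mul_le_of_le_one_right hA0
        (Real.rpow_le_one (norm_nonneg _) (hm1 ζ hζ) (by positivity))
    change ‖(φ ζ).1‖ ^ 2 + ‖(φ ζ).2‖ ^ (2 * μ) < 1
    rw [e1, e2, ← add_div, div_lt_one (by positivity)]
    linarith
  · simp [hφ]
  · rw [hφd.deriv]
    simp [Prod.smul_mk]

/-- The case `b > p ^ μ` of `exists_eggDomain_disc`: the second component of the disc has a zero at
`α`, which is found by the intermediate value theorem. -/
theorem exists_eggDomain_disc_zero {μ p b : ℝ} (hμ : 0 < μ) (hμ1 : μ ≤ 1 / 2) (hp : 0 < p)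
    (hp1 : p < 1) (hbq : p ^ μ < b) (hb1 : b < 1) : ∃ α : ℝ, p < α ∧ α ≤ 1 ∧
      b * (p ^ (1 - μ) * (1 - p ^ (2 * μ)) / μ) =
        p * ((1 - α ^ 2) / α + α * (1 - (p / α) ^ (2 * μ)) / μ) ∧
      (1 - p ^ (2 * μ)) * (1 - b ^ 2) ≤
        (1 - (p / α) ^ (2 * μ)) * (1 - (p / α) ^ (2 * μ) * α ^ 2) := by
  set c := p ^ (2 * μ) with hc
  set q := p ^ μ with hq
  have hq0 : 0 < q := Real.rpow_pos_of_pos hp _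
  have hcq : c = q ^ 2 := by rw [hc, hq, ← Real.rpow_natCast, ← Real.rpow_mul hp.le]; ring_nf
  have hc1 : c < 1 := Real.rpow_lt_one hp.le hp1 (by positivity)
  have hpq : p ^ (1 - μ) = p / q := by rw [Real.rpow_sub hp, Real.rpow_one]
  have h1c : 0 < 1 - c := by linarith
  -- the value of `b` that belongs to the zero `α`; `S 1 = p ^ μ` and `S p ≥ 1`
  set S : ℝ → ℝ := fun α => q / (1 - c) *
    (μ * (1 - α ^ 2) / α + α * (1 - (p / α) ^ (2 * μ))) with hS
  have hScont : ContinuousOn S (Icc p 1) := by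
    have hne : ∀ x ∈ Icc p 1, x ≠ 0 := fun x hx => (hp.trans_le hx.1).ne'
    refine ContinuousOn.mul continuousOn_const (ContinuousOn.add ?_ ?_)
    · exact ContinuousOn.div (by fun_prop) continuousOn_id hne
    · refine continuousOn_id.mul (continuousOn_const.sub ?_)
      exact (continuousOn_const.div continuousOn_id hne).rpow_const
        (fun x hx => Or.inr (by positivity))
  have hS1 : S 1 = q := by
    simp only [hS, div_one, ← hc]
    field_simp
    ring
  have hSp : 1 ≤ S p := by
    have h := one_sub_rpow_mul_le hμ.le (by linarith) hp hp1.le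
    rw [← hc, hpq] at h
    simp only [hS, div_self hp.ne', Real.one_rpow, sub_self, mul_zero, add_zero]
    rw [div_mul_div_comm, le_div_iff₀ (by positivity)]
    have h2 := mul_le_mul_of_nonneg_left h hq0.le
    have : q * ((1 - c) * (p / q)) = (1 - c) * p := by field_simp
    linarith
  obtain ⟨α, hα, hSα⟩ := intermediate_value_Icc' hp1.le hScont
    (show b ∈ Icc (S 1) (S p) from ⟨by rw [hS1]; exact hbq.le, by linarith⟩)
  have hα0 : 0 < α := hp.trans_le hα.1
  have hαp : p < α := by
    rcases hα.1.eq_or_lt with h | h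
    · rw [← h] at hSα; linarith
    · exact h
  set A := (p / α) ^ (2 * μ) with hA
  have ha1 : p / α < 1 := (div_lt_one hα0).2 hαp
  have hA0 : 0 ≤ A := by positivity
  have hA1 : A < 1 := Real.rpow_lt_one (by positivity) ha1 (by positivity)
  set u := α ^ (2 * μ) with hu
  have hu0 : 0 < u := Real.rpow_pos_of_pos hα0 _
  have hAu : A * u = c := by
    rw [hA, hu, Real.div_rpow hp.le hα0.le, ← hc]; field_simp
  set κ := μ * (1 - α ^ 2) / α with hκ
  have hακ : α * κ = μ * (1 - α ^ 2) := by rw [hκ]; field_simp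
  have h1α : 0 ≤ 1 - α ^ 2 := by nlinarith [hα.2]
  have hκ0 : 0 ≤ κ := by positivity
  have hb' : b * (1 - c) = q * (κ + α * (1 - A)) := by
    rw [← hSα]
    simp only [hS, ← hA, ← hκ]
    field_simp
  have hu1 : u ≤ 1 := Real.rpow_le_one hα0.le hα.2 (by positivity)
  have hle := sq_one_sub_le_of_one_sub_le (u := u) (κ := κ) (A := A) hα0 hα.2
    (by
      have := Real.rpow_le_rpow_of_exponent_ge hα0 hα.2 (by linarith : 2 * μ ≤ 1)
      rwa [Real.rpow_one] at this) hu1 hκ0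
    (by
      have h := one_sub_rpow_mul_le hμ.le (by linarith) hα0 hα.2
      rw [← hu, ← hακ] at h
      have h2 := mul_self_le_mul_self
        (mul_nonneg (by linarith) (Real.rpow_nonneg hα0.le _)) h
      have e : α ^ (1 - μ) * α ^ (1 - μ) * u = α ^ 2 := by
        rw [hu, ← Real.rpow_add hα0, ← Real.rpow_add hα0, ← Real.rpow_two]; ring_nf
      have h3 := mul_le_mul_of_nonneg_right h2 hu0.le
      have h4 : α ^ 2 * (1 - u) ^ 2 ≤ α ^ 2 * (u * κ ^ 2) := by
        calc α ^ 2 * (1 - u) ^ 2 = (1 - u) * α ^ (1 - μ) * ((1 - u) * α ^ (1 - μ)) * u := by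
              rw [← e]; ring
          _ ≤ _ := h3
          _ = _ := by ring
      exact le_of_mul_le_mul_left h4 (by positivity))
    (by
      have h := mul_le_rpow_mul hμ.le hμ1 hα0 hα.2
      rw [← hu] at h
      have h2 := mul_le_mul_of_nonneg_right h (by linarith : 0 ≤ 1 + α)
      have h3 : α * (1 + α - α * κ) ≤ α * (u * (1 + α + κ)) := by
        have e : α * (u * (1 + α + κ)) = u * (α * (1 + α) + α * κ) := by ring
        rw [e, hακ]
        nlinarith
      exact le_of_mul_le_mul_left h3 hα0)
    (by nlinarith) hA0 hA1.le
    (by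
      rw [hAu]
      have : q * (1 - c) ≤ q * (κ + α * (1 - A)) := by
        rw [← hb']; exact mul_le_mul_of_nonneg_right hbq.le h1c.le
      exact le_of_mul_le_mul_left this hq0)
  rw [hAu] at hle
  refine ⟨α, hαp, hα.2, ?_, ?_⟩
  · rw [← hA]
    calc b * (p ^ (1 - μ) * (1 - c) / μ) = p / (q * μ) * (b * (1 - c)) := by
          rw [hpq]; ring
      _ = p / (q * μ) * (q * (μ * (1 - α ^ 2) / α + α * (1 - A))) := by rw [hb']
      _ = _ := by clear_value A q; field_simp
  · rw [← hA]
    have e : c * (κ + α * (1 - A)) ^ 2 = b ^ 2 * (1 - c) ^ 2 := by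
      rw [← mul_pow, hb', mul_pow, hcq]
    rw [e] at hle
    have : (1 - c) * ((1 - c) * (1 - b ^ 2)) ≤ (1 - c) * ((1 - A) * (1 - A * α ^ 2)) := by
      nlinarith
    exact le_of_mul_le_mul_left this h1c

/-- Data of a disc of `kobayashiMetric_eggDomain_le` through `(0, p)` whose derivative has second
component `-b p ^ (1 - μ) (1 - p ^ (2 μ)) / μ` and as first component any `c` with
`‖c‖ ^ 2 ≤ (1 - p ^ (2 μ)) (1 - b ^ 2)`. For `b ≤ p ^ μ` the second component of the disc has no zero
and the disc is the image of a geodesic of the unit ball under `(z, w) ↦ (z, w ^ (1 / μ))`; for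
larger `b` the second component has a zero at `α`. -/
theorem exists_eggDomain_disc {μ p b : ℝ} (hμ : 0 < μ) (hμ1 : μ ≤ 1 / 2) (hp : 0 < p) (hp1 : p < 1)
    (hb : 0 ≤ b) (hb1 : b < 1) : ∃ (a α : ℝ) (m : ℂ → ℂ), 0 ≤ a ∧ a < 1 ∧ 0 ≤ α ∧ α ≤ 1 ∧
      DifferentiableOn ℂ m (Metric.ball 0 1) ∧ (∀ ζ ∈ Metric.ball (0 : ℂ) 1, ‖m ζ‖ ≤ 1) ∧
      (a : ℂ) * m 0 = p ∧
      (a : ℂ) * (deriv m 0 - m 0 * (α * (1 - a ^ (2 * μ)) / μ : ℝ)) =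
        -((b * (p ^ (1 - μ) * (1 - p ^ (2 * μ)) / μ) : ℝ) : ℂ) ∧
      (1 - p ^ (2 * μ)) * (1 - b ^ 2) ≤ (1 - a ^ (2 * μ)) * (1 - a ^ (2 * μ) * α ^ 2) := by
  set c := p ^ (2 * μ) with hc
  set q := p ^ μ with hq
  have hq0 : 0 < q := Real.rpow_pos_of_pos hp _
  have hcq : c = q ^ 2 := by rw [hc, hq, ← Real.rpow_natCast, ← Real.rpow_mul hp.le]; ring_nf
  have hc1 : c < 1 := Real.rpow_lt_one hp.le hp1 (by positivity)
  have hpq : p ^ (1 - μ) = p / q := by rw [Real.rpow_sub hp, Real.rpow_one]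
  have h1c : 0 < 1 - c := by linarith
  rcases le_or_gt b q with hbq | hbq
  · refine ⟨p, b / q, fun _ => 1, hp.le, hp1, by positivity, (div_le_one hq0).2 hbq,
      differentiableOn_const _, by simp, by simp, ?_, ?_⟩
    · rw [hpq, deriv_const]
      push_cast
      ring
    · rw [← hc]
      apply le_of_eq
      rw [hcq]
      field_simp
  · obtain ⟨α, hαp, hα1, hB, hle⟩ := exists_eggDomain_disc_zero hμ hμ1 hp hp1 hbq hb1
    have hα0 : 0 < α := hp.trans hαp
    have ha1 : p / α < 1 := (div_lt_one hα0).2 hαp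
    have h1α : 0 ≤ 1 - α ^ 2 := by nlinarith
    have hden : ∀ ζ ∈ Metric.ball (0 : ℂ) 1, 1 - (α : ℂ) * ζ ≠ 0 := fun ζ hζ =>
      Complex.slitPlane_ne_zero
        (one_sub_mul_mem_slitPlane hα0.le hα1 (mem_ball_zero_iff.1 hζ))
    refine ⟨p / α, α, fun ζ => (α - ζ) / (1 - α * ζ), by positivity, ha1, hα0.le, hα1, ?_, ?_, ?_,
      ?_, ?_⟩
    · exact DifferentiableOn.div (by fun_prop) (by fun_prop) hden
    · intro ζ hζ
      have hζ1 := mem_ball_zero_iff.1 hζ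
      have h := norm_one_sub_mul_sq_sub α ζ
      have h2 : 0 ≤ (1 - α ^ 2) * (1 - ‖ζ‖ ^ 2) :=
        mul_nonneg h1α (by nlinarith [norm_nonneg ζ])
      rw [norm_div, norm_sub_rev]
      exact div_le_one_of_le₀ (abs_le_of_sq_le_sq' (by linarith) (norm_nonneg _)).2 (norm_nonneg _)
    · have : (α : ℂ) ≠ 0 := by exact_mod_cast hα0.ne'
      push_cast
      simp
      field_simp
    · have hderiv : deriv (fun ζ : ℂ => (α - ζ) / (1 - α * ζ)) 0 = -(1 - (α : ℂ) ^ 2) := by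
        have h := (((hasDerivAt_id (0 : ℂ)).const_sub (α : ℂ)).div
          (((hasDerivAt_id (0 : ℂ)).const_mul (α : ℂ)).const_sub 1) (by simp)).deriv
        refine h.trans ?_
        simp
        ring
      rw [hB, hderiv]
      have h0 : (α : ℂ) ≠ 0 := by exact_mod_cast hα0.ne'
      have h1 : (μ : ℂ) ≠ 0 := by exact_mod_cast hμ.ne'
      generalize (p / α) ^ (2 * μ) = A
      push_cast
      simp only [sub_zero, mul_zero, div_one]
      field_simp
      ring
    · exact hle

theorem subset_kobayashiIndicatrix_eggDomain {μ p : ℝ} (hμ : 0 < μ) (hμ1 : μ ≤ 1 / 2) (hp : 0 < p)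
    (hp1 : p < 1) :
    {v : ℂ × ℂ | ‖v.1‖ ^ 2 / (1 - p ^ (2 * μ)) +
      ‖v.2‖ ^ 2 / (p ^ (1 - μ) * (1 - p ^ (2 * μ)) / μ) ^ 2 < 1} ⊆
      kobayashiIndicatrix (eggDomain μ) ((0 : ℂ), (p : ℂ)) := by
  intro v hv
  rw [mem_ofPred_eq] at hv
  have hc1 : 0 < 1 - p ^ (2 * μ) := by
    linarith [Real.rpow_lt_one hp.le hp1 (by positivity : 0 < 2 * μ)]
  set B := p ^ (1 - μ) * (1 - p ^ (2 * μ)) / μ with hB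
  have hB0 : 0 < B := by positivity
  -- a dilation by `s < 1` gives the strict inequality `kobayashiMetric < 1`
  obtain ⟨s, hs0, hs1, hvs⟩ : ∃ s : ℝ, 0 < s ∧ s < 1 ∧
      ‖v.1‖ ^ 2 / (1 - p ^ (2 * μ)) + ‖v.2‖ ^ 2 / B ^ 2 < s ^ 2 := by
    have h0 : 0 ≤ ‖v.1‖ ^ 2 / (1 - p ^ (2 * μ)) + ‖v.2‖ ^ 2 / B ^ 2 := by positivity
    obtain ⟨y, hy0, hy1⟩ := exists_between hv
    refine ⟨√y, Real.sqrt_pos.2 (h0.trans_lt hy0), ?_, by rwa [Real.sq_sqrt (h0.trans hy0.le)]⟩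
    rw [Real.sqrt_lt' one_pos]; simpa using hy1
  set b := ‖v.2‖ / (s * B) with hb
  have hb0 : 0 ≤ b := by positivity
  have hvs' : ‖v.1‖ ^ 2 / s ^ 2 < (1 - p ^ (2 * μ)) * (1 - b ^ 2) := by
    have h : (‖v.1‖ ^ 2 / (1 - p ^ (2 * μ)) + ‖v.2‖ ^ 2 / B ^ 2) / s ^ 2 < 1 :=
      (div_lt_one (by positivity)).2 hvs
    have e : (‖v.1‖ ^ 2 / (1 - p ^ (2 * μ)) + ‖v.2‖ ^ 2 / B ^ 2) / s ^ 2
        = ‖v.1‖ ^ 2 / s ^ 2 / (1 - p ^ (2 * μ)) + b ^ 2 := by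
      rw [hb]; field_simp
    rw [e] at h
    have h2 : ‖v.1‖ ^ 2 / s ^ 2 / (1 - p ^ (2 * μ)) < 1 - b ^ 2 := by linarith
    rw [div_lt_iff₀ hc1] at h2
    linarith
  have hb1 : b < 1 := by
    have h0 : 0 ≤ ‖v.1‖ ^ 2 / s ^ 2 := by positivity
    have : 0 < 1 - b ^ 2 := pos_of_mul_pos_right (h0.trans_lt hvs') hc1.le
    nlinarith
  obtain ⟨a, α, m, ha, ha1, hα, hα1, hm, hm1, hpt, hder, hle⟩ :=
    exists_eggDomain_disc hμ hμ1 hp hp1 hb0 hb1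
  -- a unimodular number with the argument of `v.2`
  obtain ⟨e, he1, hev⟩ : ∃ e : ℂ, ‖e‖ = 1 ∧ e * ‖v.2‖ = v.2 := by
    refine ⟨Complex.exp (v.2.arg * Complex.I), Complex.norm_exp_ofReal_mul_I _, ?_⟩
    rw [mul_comm]
    exact Complex.norm_mul_exp_arg_mul_I v.2
  have he0 : e ≠ 0 := norm_pos_iff.1 (by rw [he1]; exact one_pos)
  set l : ℂ := -(s * e) with hl
  have hs0' : (s : ℂ) ≠ 0 := by exact_mod_cast hs0.ne'
  have hB0' : (B : ℂ) ≠ 0 := by exact_mod_cast hB0.ne'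
  have hl0 : l ≠ 0 := neg_ne_zero.2 (mul_ne_zero hs0' he0)
  have hln : ‖l‖ = s := by
    rw [hl, norm_neg, norm_mul, he1, mul_one, Complex.norm_real, Real.norm_of_nonneg hs0.le]
  have h := kobayashiMetric_eggDomain_le (c := v.1 / l) (l := l) hμ ha ha1 hα hα1 hm hm1
    (by rw [norm_div, hln, div_pow]; exact hvs'.le.trans hle)
  rw [hpt, hder] at h
  have hv2 : l * -((b * B : ℝ) : ℂ) = v.2 := by
    rw [hl, hb, ← hev]
    push_cast
    rw [norm_mul, he1]
    simp only [Complex.norm_real, norm_norm, one_mul]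
    field_simp
  rw [hv2, mul_div_cancel₀ _ hl0] at h
  refine h.trans_lt ?_
  rw [← ofReal_norm, hln, ENNReal.ofReal_lt_one]
  exact hs1

/-! ### Circle averages and integration in polar coordinates -/

theorem circleAverage_norm_add_mul_sq {q : ℂ → ℂ} {r : ℝ} (a : ℂ) (hr : 0 ≤ r)
    (hq : DifferentiableOn ℂ q (Metric.closedBall 0 r)) :
    Real.circleAverage (fun w => ‖a + w * q w‖ ^ 2) 0 r =
      ‖a‖ ^ 2 + r ^ 2 * Real.circleAverage (fun w => ‖q w‖ ^ 2) 0 r := by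
  have hsub : Metric.sphere (0 : ℂ) |r| ⊆ Metric.closedBall 0 r := by
    rw [abs_of_nonneg hr]; exact Metric.sphere_subset_closedBall
  have hqc : ContinuousOn q (Metric.sphere 0 |r|) := hq.continuousOn.mono hsub
  -- the cross term is the real part of a holomorphic function vanishing at `0`
  set L : ℂ → ℂ := fun w => 2 * starRingEnd ℂ a * (w * q w) with hL
  have hLd : DifferentiableOn ℂ L (Metric.closedBall 0 r) :=
    (differentiableOn_id.mul hq).const_mul _
  have hLi : CircleIntegrable L 0 r := (hLd.continuousOn.mono hsub).circleIntegrable'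
  have hL0 : Real.circleAverage L 0 r = 0 := by
    rw [DiffContOnCl.circleAverage]
    · simp [hL]
    · rw [abs_of_nonneg hr]
      exact hLd.diffContOnCl_ball le_rfl
  have hLre : Real.circleAverage (fun w => (L w).re) 0 r = 0 := by
    have := Complex.reCLM.circleAverage_comp_comm hLi
    rw [hL0, map_zero] at this
    exact this
  have hq2 : CircleIntegrable (fun w => r ^ 2 * ‖q w‖ ^ 2) 0 r :=
    (continuousOn_const.mul (hqc.norm.pow 2)).circleIntegrable'
  have hLre' : CircleIntegrable (fun w => (L w).re) 0 r :=
    (Complex.continuous_re.comp_continuousOn (hLd.continuousOn.mono hsub)).circleIntegrable'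
  have hc : CircleIntegrable (fun _ : ℂ => ‖a‖ ^ 2) 0 r := continuousOn_const.circleIntegrable'
  have hcongr : Real.circleAverage (fun w => ‖a + w * q w‖ ^ 2) 0 r =
      Real.circleAverage (fun w => ‖a‖ ^ 2 + r ^ 2 * ‖q w‖ ^ 2 + (L w).re) 0 r := by
    refine Real.circleAverage_congr_sphere fun w hw => ?_
    have hw' : ‖w‖ = r := by simpa [abs_of_nonneg hr] using hw
    have h1 : r ^ 2 * ‖q w‖ ^ 2 = ‖w * q w‖ ^ 2 := by rw [norm_mul, hw', mul_pow]
    simp only [h1, hL]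
    simp only [Complex.sq_norm, Complex.normSq_apply]
    simp
    ring
  have hsmul : Real.circleAverage (fun w => r ^ 2 * ‖q w‖ ^ 2) 0 r =
      r ^ 2 * Real.circleAverage (fun w => ‖q w‖ ^ 2) 0 r :=
    Real.circleAverage_fun_smul (a := r ^ 2) (f := fun w => ‖q w‖ ^ 2)
  have hsum : CircleIntegrable (fun w => ‖a‖ ^ 2 + r ^ 2 * ‖q w‖ ^ 2) 0 r :=
    CircleIntegrable.add hc hq2
  rw [hcongr, Real.circleAverage_fun_add hsum hLre', hLre, add_zero,
    Real.circleAverage_fun_add hc hq2, hsmul, Real.circleAverage_const]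

/-- Parseval's identity for polynomials. -/
theorem circleAverage_norm_sum_sq (N : ℕ) (c : ℕ → ℂ) {r : ℝ} (hr : 0 ≤ r) :
    Real.circleAverage (fun w => ‖∑ k ∈ Finset.range N, c k * w ^ k‖ ^ 2) 0 r =
      ∑ k ∈ Finset.range N, ‖c k‖ ^ 2 * r ^ (2 * k) := by
  induction N generalizing c with
  | zero => simp [Real.circleAverage_const]
  | succ N ih =>
    have h := circleAverage_norm_add_mul_sq (q := fun w => ∑ k ∈ Finset.range N, c (k + 1) * w ^ k)
      (c 0) hr (by fun_prop)
    rw [ih (fun k => c (k + 1)), Finset.mul_sum] at h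
    have e1 : (fun w => ‖∑ k ∈ Finset.range (N + 1), c k * w ^ k‖ ^ 2) =
        fun w : ℂ => ‖c 0 + w * ∑ k ∈ Finset.range N, c (k + 1) * w ^ k‖ ^ 2 := by
      funext w
      rw [Finset.sum_range_succ', add_comm, Finset.mul_sum, pow_zero, mul_one]
      congr 3
      exact Finset.sum_congr rfl fun k _ => by ring
    rw [e1, h, Finset.sum_range_succ', add_comm, mul_zero, pow_zero, mul_one]
    congr 1
    exact Finset.sum_congr rfl fun k _ => by ring

/-- Bessel's inequality for the Taylor coefficients at `0`, which are the values at `0` of the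
iterated difference quotients. -/
theorem sum_norm_sq_mul_pow_le_circleAverage (N : ℕ) {h : ℂ → ℂ} {r : ℝ} (hr : 0 < r)
    (hh : DifferentiableOn ℂ h (Metric.closedBall 0 r)) :
    ∑ k ∈ Finset.range N, ‖(Function.swap dslope 0)^[k] h 0‖ ^ 2 * r ^ (2 * k) ≤
      Real.circleAverage (fun w => ‖h w‖ ^ 2) 0 r := by
  induction N generalizing h with
  | zero =>
    simp only [Finset.range_zero, Finset.sum_empty]
    exact Real.circleAverage_nonneg_of_nonneg fun _ _ => by positivity
  | succ N ih =>
    have hd : DifferentiableOn ℂ (dslope h 0) (Metric.closedBall 0 r) :=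
      (Complex.differentiableOn_dslope (Metric.closedBall_mem_nhds 0 hr)).2 hh
    have h1 := circleAverage_norm_add_mul_sq (h 0) hr.le hd
    have h2 : (fun w => ‖h 0 + w * dslope h 0 w‖ ^ 2) = fun w => ‖h w‖ ^ 2 := by
      ext w
      have := sub_smul_dslope h 0 w
      rw [sub_zero, smul_eq_mul] at this
      rw [this]; ring_nf
    rw [h2] at h1
    rw [h1, Finset.sum_range_succ', add_comm]
    simp only [Function.iterate_succ_apply, Function.iterate_zero, id_eq, mul_zero, pow_zero,
      mul_one]
    gcongr
    refine le_trans (le_of_eq ?_) (mul_le_mul_of_nonneg_left (ih hd) (sq_nonneg r))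
    rw [Finset.mul_sum]
    exact Finset.sum_congr rfl fun k _ => by simp only [Function.swap]; ring

/-- Integration in polar coordinates of the product of a radial function and `‖h‖ ^ 2`. -/
theorem lintegral_radial_mul_enorm_sq {h : ℂ → ℂ} {R : ℝ} {Φ : ℝ → ℝ≥0∞}
    (hh : ContinuousOn h (Metric.ball 0 R)) (hΦ : Measurable Φ) (hΦR : ∀ r, R ≤ r → Φ r = 0) :
    ∫⁻ w, Φ ‖w‖ * ‖h w‖ₑ ^ 2 = ∫⁻ r in Ioo 0 R,
      ENNReal.ofReal (2 * Real.pi * r * Real.circleAverage (fun w => ‖h w‖ ^ 2) 0 r) * Φ r := by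
  set h' := (Metric.ball (0 : ℂ) R).indicator h with hh'
  have hmeas : Measurable h' := by
    classical
    have : Measurable ((Metric.ball (0 : ℂ) R).piecewise h 0) :=
      hh.measurable_piecewise continuousOn_const Metric.isOpen_ball.measurableSet
    simpa [hh', ← piecewise_eq_indicator] using this
  have e1 : ∀ w, Φ ‖w‖ * ‖h w‖ₑ ^ 2 = Φ ‖w‖ * ‖h' w‖ₑ ^ 2 := by
    intro w
    by_cases hw : w ∈ Metric.ball (0 : ℂ) R
    · rw [hh', indicator_of_mem hw]
    · have : Φ ‖w‖ = 0 := hΦR _ (by simpa using hw)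
      rw [this, zero_mul, zero_mul]
  have hsymm : ∀ x : ℝ × ℝ, Complex.polarCoord.symm x = circleMap 0 x.1 x.2 := by
    intro x
    rw [Complex.polarCoord_symm_apply, circleMap, zero_add, Complex.exp_mul_I]
    push_cast
    ring
  have hF : Measurable fun w : ℂ => Φ ‖w‖ * ‖h' w‖ₑ ^ 2 :=
    (hΦ.comp measurable_norm).mul (hmeas.enorm.pow_const 2)
  have hcm : Continuous fun x : ℝ × ℝ => circleMap 0 x.1 x.2 := by
    unfold circleMap; fun_prop
  simp_rw [e1]
  rw [← Complex.lintegral_comp_polarCoord_symm, polarCoord_target, Measure.volume_eq_prod]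
  simp only [hsymm, smul_eq_mul]
  rw [setLIntegral_prod _ ?_]
  swap
  · exact ((measurable_fst.ennreal_ofReal).mul (hF.comp hcm.measurable)).aemeasurable
  have e2 : ∫⁻ r in Ioi (0 : ℝ), ∫⁻ θ in Ioo (-Real.pi) Real.pi, ENNReal.ofReal r *
      (Φ ‖circleMap 0 r θ‖ * ‖h' (circleMap 0 r θ)‖ₑ ^ 2) =
      ∫⁻ r in Ioi (0 : ℝ), (Ioo 0 R).indicator (fun r => ENNReal.ofReal (2 * Real.pi * r *
        Real.circleAverage (fun w => ‖h w‖ ^ 2) 0 r) * Φ r) r := by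
    refine setLIntegral_congr_fun measurableSet_Ioi fun r hr => ?_
    have hr0 : 0 < r := hr
    have hnorm : ∀ θ, ‖circleMap 0 r θ‖ = r := fun θ => by simp [abs_of_pos hr0]
    simp only [hnorm]
    rcases lt_or_ge r R with hrR | hrR
    · rw [indicator_of_mem (show r ∈ Ioo 0 R from ⟨hr0, hrR⟩)]
      have hmem : ∀ θ, circleMap 0 r θ ∈ Metric.ball (0 : ℂ) R := fun θ => by
        rw [mem_ball_zero_iff, hnorm]; exact hrR
      have hcont : Continuous fun θ => ‖h (circleMap 0 r θ)‖ ^ 2 := by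
        have : Continuous fun θ => h (circleMap 0 r θ) :=
          hh.comp_continuous (continuous_circleMap 0 r) hmem
        exact this.norm.pow 2
      have e3 : ∫⁻ θ in Ioo (-Real.pi) Real.pi, ‖h' (circleMap 0 r θ)‖ₑ ^ 2 =
          ENNReal.ofReal (2 * Real.pi * Real.circleAverage (fun w => ‖h w‖ ^ 2) 0 r) := by
        have hle : -Real.pi ≤ Real.pi := by linarith [Real.pi_pos]
        have hper : Function.Periodic (fun θ => ‖h (circleMap 0 r θ)‖ ^ 2) (2 * Real.pi) :=
          fun x => by simp [periodic_circleMap 0 r x]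
        have hI := hper.intervalIntegral_add_eq (-Real.pi) 0
        rw [zero_add, show -Real.pi + 2 * Real.pi = Real.pi by ring] at hI
        rw [Real.circleAverage_def, smul_eq_mul, ← mul_assoc,
          mul_inv_cancel₀ (by positivity), one_mul, ← hI, intervalIntegral.integral_of_le hle,
          integral_Ioc_eq_integral_Ioo, ofReal_integral_eq_lintegral_ofReal]
        · refine lintegral_congr fun θ => ?_
          rw [hh', indicator_of_mem (hmem θ), ← ofReal_norm, ENNReal.ofReal_pow (norm_nonneg _)]
        · exact (hcont.integrableOn_Icc (a := -Real.pi) (b := Real.pi)).mono_set Ioo_subset_Icc_self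
        · exact Filter.Eventually.of_forall fun θ => by positivity
      rw [lintegral_const_mul', lintegral_const_mul'', e3]
      · rw [show 2 * Real.pi * r * Real.circleAverage (fun w => ‖h w‖ ^ 2) 0 r =
          r * (2 * Real.pi * Real.circleAverage (fun w => ‖h w‖ ^ 2) 0 r) by ring,
          ENNReal.ofReal_mul hr0.le]
        ring
      · exact ((hmeas.comp (continuous_circleMap 0 r).measurable).enorm.pow_const 2).aemeasurable
      · exact ENNReal.ofReal_ne_top
    · rw [indicator_of_notMem (fun hmem => absurd hmem.2 (not_lt.2 hrR)), hΦR r hrR]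
      simp
  rw [e2, setLIntegral_indicator measurableSet_Ioo]
  congr 2
  ext r
  simp only [mem_inter_iff, mem_Ioo, mem_Ioi]
  tauto

theorem lintegral_Ioo_ofReal_eq {F : ℝ → ℝ} {R : ℝ} (hR : 0 ≤ R) (hF : ContinuousOn F (Icc 0 R))
    (h0 : ∀ r ∈ Ioo 0 R, 0 ≤ F r) :
    ∫⁻ r in Ioo 0 R, ENNReal.ofReal (F r) = ENNReal.ofReal (∫ r in 0..R, F r) := by
  rw [intervalIntegral.integral_of_le hR, integral_Ioc_eq_integral_Ioo,
    ofReal_integral_eq_lintegral_ofReal]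
  · exact hF.integrableOn_Icc.mono_set Ioo_subset_Icc_self
  · exact (ae_restrict_iff' measurableSet_Ioo).2 (Filter.Eventually.of_forall h0)

theorem volume_norm_sq_lt (s : ℝ) :
    volume {z : ℂ | ‖z‖ ^ 2 < s} = ENNReal.ofReal (Real.pi * s) := by
  rcases le_or_gt s 0 with hs | hs
  · have : {z : ℂ | ‖z‖ ^ 2 < s} = ∅ := by
      ext z
      simp only [mem_ofPred_eq, mem_empty_iff_false, iff_false, not_lt]
      exact hs.trans (by positivity)
    rw [this, measure_empty, ENNReal.ofReal_of_nonpos]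
    exact mul_nonpos_of_nonneg_of_nonpos Real.pi_pos.le hs
  · have : {z : ℂ | ‖z‖ ^ 2 < s} = Metric.ball 0 √s := by
      ext z
      rw [mem_ofPred_eq, mem_ball_zero_iff, Real.lt_sqrt (norm_nonneg z)]
    rw [this, Complex.volume_ball, ← ENNReal.ofReal_pow (Real.sqrt_nonneg s), Real.sq_sqrt hs.le,
      mul_comm, ENNReal.ofReal_mul Real.pi_pos.le]
    congr 1
    rw [← NNReal.coe_real_pi, ENNReal.ofReal_coe_nnreal]

theorem volume_ellipsoid {X B : ℝ} (hX : 0 < X) (hB : 0 < B) :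
    volume {v : ℂ × ℂ | ‖v.1‖ ^ 2 / X + ‖v.2‖ ^ 2 / B ^ 2 < 1} =
      ENNReal.ofReal (Real.pi ^ 2 * X * B ^ 2 / 2) := by
  have hopen : MeasurableSet {v : ℂ × ℂ | ‖v.1‖ ^ 2 / X + ‖v.2‖ ^ 2 / B ^ 2 < 1} := by
    refine (isOpen_lt ?_ continuous_const).measurableSet
    fun_prop
  rw [Measure.volume_eq_prod, Measure.prod_apply_symm hopen]
  have e1 : ∀ w : ℂ, volume ((fun z : ℂ => (z, w)) ⁻¹'
      {v : ℂ × ℂ | ‖v.1‖ ^ 2 / X + ‖v.2‖ ^ 2 / B ^ 2 < 1}) =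
      ENNReal.ofReal (Real.pi * (X * (1 - ‖w‖ ^ 2 / B ^ 2))) * ‖(1 : ℂ)‖ₑ ^ 2 := by
    intro w
    rw [enorm_one, one_pow, mul_one, ← volume_norm_sq_lt]
    congr 1
    ext z
    simp only [mem_preimage, mem_ofPred_eq]
    rw [← lt_sub_iff_add_lt, div_lt_iff₀ hX, mul_comm X]
  simp_rw [e1]
  rw [lintegral_radial_mul_enorm_sq (h := fun _ => 1) (R := B)
    (Φ := fun r => ENNReal.ofReal (Real.pi * (X * (1 - r ^ 2 / B ^ 2)))) continuousOn_const
    (by fun_prop)]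
  · have e2 : ∀ r ∈ Ioo 0 B, ENNReal.ofReal (2 * Real.pi * r *
        Real.circleAverage (fun _ => ‖(1 : ℂ)‖ ^ 2) 0 r) *
        ENNReal.ofReal (Real.pi * (X * (1 - r ^ 2 / B ^ 2))) =
        ENNReal.ofReal (2 * Real.pi ^ 2 * X * (r - r ^ 3 / B ^ 2)) := by
      intro r hr
      rw [Real.circleAverage_const, norm_one, one_pow, mul_one,
        ← ENNReal.ofReal_mul (by have := hr.1; positivity)]
      congr 1
      ring
    rw [setLIntegral_congr_fun measurableSet_Ioo e2, lintegral_Ioo_ofReal_eq hB.le (by fun_prop)]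
    · congr 1
      rw [intervalIntegral.integral_const_mul, intervalIntegral.integral_sub (by simp)
        (Continuous.intervalIntegrable (by fun_prop) _ _), intervalIntegral.integral_div,
        integral_id, integral_pow]
      field_simp
      ring
    · intro r hr
      have : 0 ≤ r - r ^ 3 / B ^ 2 := by
        rw [sub_nonneg, div_le_iff₀ (by positivity)]
        have : r ^ 2 ≤ B ^ 2 := by have := hr.1; have := hr.2; gcongr
        nlinarith [hr.1]
      positivity
  · intro r hr
    apply ENNReal.ofReal_of_nonpos
    have h1 : 1 ≤ r ^ 2 / B ^ 2 := by
      rw [one_le_div (by positivity)]; gcongr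
    exact mul_nonpos_of_nonneg_of_nonpos Real.pi_pos.le
      (mul_nonpos_of_nonneg_of_nonpos hX.le (by linarith))

/-! ### The Bergman kernel of the egg domain -/

/-- The squared norm of the monomial `w ^ k` in the Bergman space of the egg domain. -/
noncomputable def eggMoment (μ : ℝ) (k : ℕ) : ℝ :=
  Real.pi ^ 2 * μ / ((k + 1) * (k + 1 + μ))

theorem eggMoment_pos {μ : ℝ} (hμ : 0 < μ) (k : ℕ) : 0 < eggMoment μ k := by
  unfold eggMoment; positivity

theorem integral_eggMoment {μ : ℝ} (hμ : 0 < μ) (k : ℕ) :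
    ∫ r in (0 : ℝ)..1, 2 * Real.pi * r * r ^ (2 * k) * (Real.pi * (1 - r ^ (2 * μ))) =
      eggMoment μ k := by
  have e : ∀ r ∈ uIcc (0 : ℝ) 1, 2 * Real.pi * r * r ^ (2 * k) * (Real.pi * (1 - r ^ (2 * μ))) =
      2 * Real.pi ^ 2 * (r ^ (2 * k + 1) - r ^ ((2 * k + 1 : ℝ) + 2 * μ)) := by
    intro r hr
    rw [uIcc_of_le zero_le_one] at hr
    have : r ^ ((2 * k + 1 : ℝ) + 2 * μ) = r ^ (2 * k + 1) * r ^ (2 * μ) := by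
      rw [Real.rpow_add_of_nonneg hr.1 (by positivity) (by positivity), ← Real.rpow_natCast]
      push_cast
      rfl
    rw [this]
    ring
  rw [intervalIntegral.integral_congr e, intervalIntegral.integral_const_mul,
    intervalIntegral.integral_sub (by simp)
      (intervalIntegral.intervalIntegrable_rpow (Or.inl (by positivity))), integral_pow,
    integral_rpow (Or.inl (by have : (0 : ℝ) ≤ k := by positivity
                              linarith)), eggMoment]
  have h1 : (2 * k + 1 : ℝ) + 2 * μ + 1 ≠ 0 := by positivity
  have h2 : ((2 * k + 1 : ℕ) : ℝ) + 1 ≠ 0 := by positivity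
  rw [Real.one_rpow, Real.zero_rpow h1]
  push_cast at h2 ⊢
  have h3 : (k : ℝ) + 1 ≠ 0 := by positivity
  have h4 : (k : ℝ) + 1 + μ ≠ 0 := by positivity
  have e1 : (2 * k + 1 : ℝ) + 2 * μ + 1 = 2 * (k + 1 + μ) := by ring
  have e2 : (2 * k + 1 : ℝ) + 1 = 2 * (k + 1) := by ring
  rw [e1, e2]
  field_simp
  ring

theorem lintegral_Ioo_sum_mul_eggWeight {μ : ℝ} (hμ : 0 < μ) (N : ℕ) (d : ℕ → ℝ)
    (hd : ∀ k, 0 ≤ d k) :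
    ∫⁻ r in Ioo (0 : ℝ) 1, ENNReal.ofReal (2 * Real.pi * r *
      ∑ k ∈ Finset.range N, d k * r ^ (2 * k)) * ENNReal.ofReal (Real.pi * (1 - r ^ (2 * μ))) =
      ENNReal.ofReal (∑ k ∈ Finset.range N, d k * eggMoment μ k) := by
  have hcont : ∀ k : ℕ, Continuous fun r : ℝ =>
      2 * Real.pi * r * r ^ (2 * k) * (Real.pi * (1 - r ^ (2 * μ))) := by
    intro k
    have := Real.continuous_rpow_const (q := 2 * μ) (by positivity)
    fun_prop
  have e : ∀ r ∈ Ioo (0 : ℝ) 1, ENNReal.ofReal (2 * Real.pi * r *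
      ∑ k ∈ Finset.range N, d k * r ^ (2 * k)) * ENNReal.ofReal (Real.pi * (1 - r ^ (2 * μ))) =
      ENNReal.ofReal (∑ k ∈ Finset.range N,
        d k * (2 * Real.pi * r * r ^ (2 * k) * (Real.pi * (1 - r ^ (2 * μ))))) := by
    intro r hr
    have hs : 0 ≤ ∑ k ∈ Finset.range N, d k * r ^ (2 * k) :=
      Finset.sum_nonneg fun k _ => mul_nonneg (hd k) (by have := hr.1; positivity)
    rw [← ENNReal.ofReal_mul (by have := hr.1; positivity), Finset.mul_sum, Finset.sum_mul]
    congr 1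
    exact Finset.sum_congr rfl fun k _ => by ring
  rw [setLIntegral_congr_fun measurableSet_Ioo e, lintegral_Ioo_ofReal_eq zero_le_one]
  · rw [intervalIntegral.integral_finsetSum]
    · simp only [intervalIntegral.integral_const_mul, integral_eggMoment hμ]
    · exact fun k _ => ((hcont k).const_mul (d k)).intervalIntegrable _ _
  · exact (continuous_finsetSum _ fun k _ => (hcont k).const_mul (d k)).continuousOn
  · intro r hr
    have h1 : 0 ≤ 1 - r ^ (2 * μ) := by
      linarith [Real.rpow_le_one hr.1.le hr.2.le (by positivity : 0 ≤ 2 * μ)]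
    exact Finset.sum_nonneg fun k _ => mul_nonneg (hd k) (by have := hr.1; positivity)

/-- The Bergman kernel of the egg domain at `(0, p)`, as an orthonormal series. -/
theorem hasSum_pow_div_eggMoment {μ p : ℝ} (hμ : 0 < μ) (hp : 0 ≤ p) (hp1 : p < 1) :
    HasSum (fun k : ℕ => p ^ (2 * k) / eggMoment μ k)
      ((1 + μ + p ^ 2 - μ * p ^ 2) / (Real.pi ^ 2 * μ * (1 - p ^ 2) ^ 3)) := by
  have hx : ‖p ^ 2‖ < 1 := by
    rw [Real.norm_of_nonneg (by positivity)]; nlinarith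
  have hx' : 0 < 1 - p ^ 2 := by nlinarith
  have h1 := hasSum_choose_mul_geometric_of_norm_lt_one 1 hx
  have h2 := hasSum_choose_mul_geometric_of_norm_lt_one 2 hx
  have h := ((h2.mul_left 2).add (h1.mul_left (μ - 1))).div_const (Real.pi ^ 2 * μ)
  have e1 : (fun k : ℕ => p ^ (2 * k) / eggMoment μ k) = fun k : ℕ =>
      (2 * (((k + 2).choose 2 : ℝ) * (p ^ 2) ^ k) +
        (μ - 1) * (((k + 1).choose 1 : ℝ) * (p ^ 2) ^ k)) / (Real.pi ^ 2 * μ) := by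
    funext k
    rw [Nat.cast_choose_two, Nat.choose_one_right, eggMoment, pow_mul]
    push_cast
    have h3 : (k : ℝ) + 1 ≠ 0 := by positivity
    have h4 : (k : ℝ) + 1 + μ ≠ 0 := by positivity
    field_simp
    ring
  have e2 : (1 + μ + p ^ 2 - μ * p ^ 2) / (Real.pi ^ 2 * μ * (1 - p ^ 2) ^ 3) =
      (2 * (1 / (1 - p ^ 2) ^ (2 + 1)) + (μ - 1) * (1 / (1 - p ^ 2) ^ (1 + 1))) /
        (Real.pi ^ 2 * μ) := by
    have : (1 - p ^ 2) ≠ 0 := hx'.ne'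
    field_simp
    ring
  rw [e1, e2]
  exact h

theorem eggDomain_weight_nonpos {μ r : ℝ} (hμ : 0 < μ) (hr : 1 ≤ r) :
    ENNReal.ofReal (Real.pi * (1 - r ^ (2 * μ))) = 0 := by
  apply ENNReal.ofReal_of_nonpos
  have := Real.one_le_rpow hr (by positivity : 0 ≤ 2 * μ)
  exact mul_nonpos_of_nonneg_of_nonpos Real.pi_pos.le (by linarith)

theorem measurable_eggWeight {μ : ℝ} :
    Measurable fun r : ℝ => ENNReal.ofReal (Real.pi * (1 - r ^ (2 * μ))) := by
  fun_prop

theorem isOpen_eggDomain {μ : ℝ} (hμ : 0 < μ) : IsOpen (eggDomain μ) := by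
  have h : Continuous fun x : ℂ × ℂ => ‖x.1‖ ^ 2 + ‖x.2‖ ^ (2 * μ) :=
    (continuous_fst.norm.pow 2).add
      ((Real.continuous_rpow_const (by positivity)).comp continuous_snd.norm)
  exact isOpen_lt h continuous_const

theorem mem_eggDomain_iff {μ : ℝ} {z w : ℂ} :
    (z, w) ∈ eggDomain μ ↔ ‖z‖ ^ 2 < 1 - ‖w‖ ^ (2 * μ) := by
  rw [lt_sub_iff_add_lt]; rfl

/-- Bessel's inequality for functions of the second variable: the weight is the area of the disc
`{z | (z, w) ∈ eggDomain μ}`. -/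
theorem sum_mul_eggMoment_le {μ : ℝ} (hμ : 0 < μ) {g : ℂ → ℂ}
    (hg : DifferentiableOn ℂ g (Metric.ball 0 1)) (N : ℕ) :
    ENNReal.ofReal (∑ k ∈ Finset.range N,
      ‖(Function.swap dslope 0)^[k] g 0‖ ^ 2 * eggMoment μ k) ≤
      ∫⁻ w, ENNReal.ofReal (Real.pi * (1 - ‖w‖ ^ (2 * μ))) * ‖g w‖ₑ ^ 2 := by
  rw [lintegral_radial_mul_enorm_sq
    (Φ := fun r => ENNReal.ofReal (Real.pi * (1 - r ^ (2 * μ)))) hg.continuousOn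
    measurable_eggWeight fun r hr => eggDomain_weight_nonpos hμ hr,
    ← lintegral_Ioo_sum_mul_eggWeight hμ N _ fun k => sq_nonneg _]
  refine setLIntegral_mono' measurableSet_Ioo fun r hr => ?_
  gcongr
  · have := hr.1; positivity
  · exact sum_norm_sq_mul_pow_le_circleAverage N hr.1
      (hg.mono (Metric.closedBall_subset_ball hr.2))

/-- The sub-mean value property on the disc `{z | (z, w) ∈ eggDomain μ}`. -/
theorem weight_mul_enorm_sq_le_lintegral {μ : ℝ} {f : ℂ × ℂ → ℂ}
    (hf : DifferentiableOn ℂ f (eggDomain μ)) (w : ℂ) :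
    ENNReal.ofReal (Real.pi * (1 - ‖w‖ ^ (2 * μ))) * ‖f (0, w)‖ₑ ^ 2 ≤
      ∫⁻ z, (eggDomain μ).indicator (fun x => ‖f x‖ₑ ^ 2) (z, w) := by
  rcases le_or_gt (1 - ‖w‖ ^ (2 * μ)) 0 with hs | hs
  · rw [ENNReal.ofReal_of_nonpos (mul_nonpos_of_nonneg_of_nonpos Real.pi_pos.le hs), zero_mul]
    exact zero_le
  set R := √(1 - ‖w‖ ^ (2 * μ)) with hR
  have hR0 : 0 < R := Real.sqrt_pos.2 hs
  have hR2 : R ^ 2 = 1 - ‖w‖ ^ (2 * μ) := Real.sq_sqrt hs.le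
  have hmem : ∀ z : ℂ, (z, w) ∈ eggDomain μ ↔ ‖z‖ < R := by
    intro z
    rw [mem_eggDomain_iff, ← hR2, sq_lt_sq₀ (norm_nonneg z) hR0.le]
  have hd : DifferentiableOn ℂ (fun z => f (z, w)) (Metric.ball 0 R) :=
    hf.comp (differentiableOn_id.prodMk (differentiableOn_const w))
      fun z hz => (hmem z).2 (mem_ball_zero_iff.1 hz)
  have e1 : ∀ z, (eggDomain μ).indicator (fun x => ‖f x‖ₑ ^ 2) (z, w) =
      (Iio R).indicator (fun _ => (1 : ℝ≥0∞)) ‖z‖ * ‖f (z, w)‖ₑ ^ 2 := by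
    intro z
    by_cases hz : ‖z‖ < R
    · rw [indicator_of_mem ((hmem z).2 hz), indicator_of_mem (show ‖z‖ ∈ Iio R from hz), one_mul]
    · rw [indicator_of_notMem (fun h => hz ((hmem z).1 h)),
        indicator_of_notMem (show ‖z‖ ∉ Iio R from hz), zero_mul]
  simp_rw [e1]
  rw [lintegral_radial_mul_enorm_sq (h := fun z => f (z, w)) (Φ := (Iio R).indicator fun _ => 1)
    hd.continuousOn (measurable_const.indicator measurableSet_Iio)
    fun r hr => indicator_of_notMem (show r ∉ Iio R from not_lt.2 hr) _]
  calc ENNReal.ofReal (Real.pi * (1 - ‖w‖ ^ (2 * μ))) * ‖f (0, w)‖ₑ ^ 2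
      = ∫⁻ r in Ioo 0 R, ENNReal.ofReal (2 * Real.pi * ‖f (0, w)‖ ^ 2 * r) := by
        rw [lintegral_Ioo_ofReal_eq hR0.le (by fun_prop)
          fun r hr => by have := hr.1; positivity, intervalIntegral.integral_const_mul,
          integral_id, ← hR2, ← ofReal_norm, ← ENNReal.ofReal_pow (norm_nonneg _),
          ← ENNReal.ofReal_mul (by positivity)]
        congr 1
        ring
    _ ≤ _ := by
        refine setLIntegral_mono' measurableSet_Ioo fun r hr => ?_
        rw [indicator_of_mem (show r ∈ Iio R from hr.2), mul_one]
        apply ENNReal.ofReal_le_ofReal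
        have h := sum_norm_sq_mul_pow_le_circleAverage 1 hr.1
          (hd.mono (Metric.closedBall_subset_ball hr.2))
        simp only [Finset.range_one, Finset.sum_singleton, Function.iterate_zero, id_eq, mul_zero,
          pow_zero, mul_one] at h
        have := hr.1
        calc 2 * Real.pi * ‖f (0, w)‖ ^ 2 * r = 2 * Real.pi * r * ‖f (0, w)‖ ^ 2 := by ring
          _ ≤ _ := by gcongr

theorem hasSum_pow_mul_iterate_dslope {g : ℂ → ℂ} (hg : DifferentiableOn ℂ g (Metric.ball 0 1))
    {y : ℂ} (hy : ‖y‖ < 1) :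
    HasSum (fun k => y ^ k * (Function.swap dslope 0)^[k] g 0) (g y) := by
  obtain ⟨R, hyR, hR1⟩ := exists_between hy
  have hR0 : 0 < R := (norm_nonneg y).trans_lt hyR
  lift R to NNReal using hR0.le
  have hps := (hg.mono (Metric.closedBall_subset_ball hR1)).hasFPowerSeriesOnBall
    (by exact_mod_cast hR0)
  have hcoef : ∀ k, (cauchyPowerSeries g 0 R).coeff k = (Function.swap dslope 0)^[k] g 0 := by
    intro k
    have h := (hps.hasFPowerSeriesAt.has_fpower_series_iterate_dslope_fslope k).coeff_zero 1
    rw [← h]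
    have := FormalMultilinearSeries.coeff_iterate_fslope (p := cauchyPowerSeries g 0 R) k 0
    rw [zero_add] at this
    rw [← this]
    rfl
  have hs := hps.hasSum (y := y) (by
    rw [Metric.mem_eball, edist_zero_right]
    rw [← ofReal_norm, ← ENNReal.ofReal_coe_nnreal]
    exact (ENNReal.ofReal_lt_ofReal_iff hR0).2 hyR)
  rw [zero_add] at hs
  refine hs.congr_fun ?_
  intro k
  rw [FormalMultilinearSeries.apply_eq_pow_smul_coeff, hcoef, smul_eq_mul]

theorem bergmanKernel_eggDomain_le {μ p : ℝ} (hμ : 0 < μ) (hp : 0 ≤ p) (hp1 : p < 1) :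
    bergmanKernel (eggDomain μ) ((0 : ℂ), (p : ℂ)) ≤
      ENNReal.ofReal ((1 + μ + p ^ 2 - μ * p ^ 2) / (Real.pi ^ 2 * μ * (1 - p ^ 2) ^ 3)) := by
  refine iSup₂_le fun f ⟨hf, hf1⟩ => ?_
  have hopen := isOpen_eggDomain hμ
  set g : ℂ → ℂ := fun w => f (0, w) with hg
  have hgd : DifferentiableOn ℂ g (Metric.ball 0 1) := by
    refine hf.comp ((differentiableOn_const 0).prodMk differentiableOn_id) fun w hw => ?_
    refine mem_eggDomain_iff.2 ?_
    have := Real.rpow_lt_one (norm_nonneg w) (mem_ball_zero_iff.1 hw) (by positivity : 0 < 2 * μ)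
    rw [norm_zero]
    linarith
  have hint : ∫⁻ w, ENNReal.ofReal (Real.pi * (1 - ‖w‖ ^ (2 * μ))) * ‖g w‖ₑ ^ 2 ≤ 1 := by
    refine le_trans (lintegral_mono fun w => weight_mul_enorm_sq_le_lintegral hf w) ?_
    rw [← lintegral_indicator hopen.measurableSet] at hf1
    refine le_trans (le_of_eq ?_) hf1
    rw [Measure.volume_eq_prod]
    refine (lintegral_prod_symm _ ?_).symm
    rw [aemeasurable_indicator_iff hopen.measurableSet]
    exact (hf.continuousOn.enorm.aemeasurable hopen.measurableSet).pow_const 2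
  set a : ℕ → ℂ := fun k => (Function.swap dslope 0)^[k] g 0 with ha
  have hbessel : ∀ N, ∑ k ∈ Finset.range N, ‖a k‖ ^ 2 * eggMoment μ k ≤ 1 := fun N => by
    have := (sum_mul_eggMoment_le hμ hgd N).trans hint
    rwa [ENNReal.ofReal_le_one] at this
  have hK := hasSum_pow_div_eggMoment hμ hp hp1
  set K := (1 + μ + p ^ 2 - μ * p ^ 2) / (Real.pi ^ 2 * μ * (1 - p ^ 2) ^ 3) with hKdef
  have hterm : ∀ k, 0 ≤ p ^ (2 * k) / eggMoment μ k := fun k =>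
    div_nonneg (by positivity) (eggMoment_pos hμ k).le
  have hK0 : 0 ≤ K := hK.nonneg hterm
  have hpart : ∀ N, ‖∑ k ∈ Finset.range N, (p : ℂ) ^ k * a k‖ ≤ √K := by
    intro N
    apply Real.le_sqrt_of_sq_le
    have h1 : ‖∑ k ∈ Finset.range N, (p : ℂ) ^ k * a k‖ ≤
        ∑ k ∈ Finset.range N, p ^ k / √(eggMoment μ k) * (‖a k‖ * √(eggMoment μ k)) := by
      refine (norm_sum_le _ _).trans (le_of_eq (Finset.sum_congr rfl fun k _ => ?_))
      have : √(eggMoment μ k) ≠ 0 := (Real.sqrt_pos.2 (eggMoment_pos hμ k)).ne'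
      rw [norm_mul, norm_pow, Complex.norm_real, Real.norm_of_nonneg hp]
      field_simp
    calc ‖∑ k ∈ Finset.range N, (p : ℂ) ^ k * a k‖ ^ 2 ≤
        (∑ k ∈ Finset.range N, p ^ k / √(eggMoment μ k) * (‖a k‖ * √(eggMoment μ k))) ^ 2 := by
          gcongr
      _ ≤ (∑ k ∈ Finset.range N, (p ^ k / √(eggMoment μ k)) ^ 2) *
          ∑ k ∈ Finset.range N, (‖a k‖ * √(eggMoment μ k)) ^ 2 :=
          Finset.sum_mul_sq_le_sq_mul_sq _ _ _
      _ = (∑ k ∈ Finset.range N, p ^ (2 * k) / eggMoment μ k) *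
          ∑ k ∈ Finset.range N, ‖a k‖ ^ 2 * eggMoment μ k := by
          congr 1 <;> refine Finset.sum_congr rfl fun k _ => ?_
          · rw [div_pow, Real.sq_sqrt (eggMoment_pos hμ k).le]; ring
          · rw [mul_pow, Real.sq_sqrt (eggMoment_pos hμ k).le]
      _ ≤ K * 1 := by
          gcongr
          · exact Finset.sum_nonneg fun k _ => mul_nonneg (sq_nonneg _) (eggMoment_pos hμ k).le
          · exact sum_le_hasSum _ (fun k _ => hterm k) hK
          · exact hbessel N
      _ = K := mul_one K
  have hlim := (hasSum_pow_mul_iterate_dslope hgd (y := (p : ℂ))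
    (by rwa [Complex.norm_real, Real.norm_of_nonneg hp])).tendsto_sum_nat.norm
  have hle : ‖f (0, (p : ℂ))‖ ≤ √K := le_of_tendsto' hlim hpart
  rw [← ofReal_norm, ← ENNReal.ofReal_pow (norm_nonneg _)]
  apply ENNReal.ofReal_le_ofReal
  calc ‖f (0, (p : ℂ))‖ ^ 2 ≤ √K ^ 2 := by gcongr
    _ = K := Real.sq_sqrt hK0

theorem le_bergmanKernel_eggDomain {μ p : ℝ} (hμ : 0 < μ) (hp : 0 ≤ p) (hp1 : p < 1) :
    ENNReal.ofReal ((1 + μ + p ^ 2 - μ * p ^ 2) / (Real.pi ^ 2 * μ * (1 - p ^ 2) ^ 3)) ≤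
      bergmanKernel (eggDomain μ) ((0 : ℂ), (p : ℂ)) := by
  have hopen := isOpen_eggDomain hμ
  have hlim := ENNReal.tendsto_ofReal (hasSum_pow_div_eggMoment hμ hp hp1).tendsto_sum_nat
  refine le_of_tendsto' hlim fun N => ?_
  set S := ∑ k ∈ Finset.range N, p ^ (2 * k) / eggMoment μ k with hS
  have hS0 : 0 ≤ S := Finset.sum_nonneg fun k _ =>
    div_nonneg (by positivity) (eggMoment_pos hμ k).le
  rcases hS0.eq_or_lt with h0 | h0
  · rw [← h0, ENNReal.ofReal_zero]; exact zero_le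
  -- the truncated kernel function, normalised
  set c : ℕ → ℂ := fun k => ((p ^ k / eggMoment μ k / √S : ℝ) : ℂ) with hc
  set P : ℂ → ℂ := fun w => ∑ k ∈ Finset.range N, c k * w ^ k with hP
  have hval : P p = ((√S : ℝ) : ℂ) := by
    have : √S = S / √S := by rw [Real.div_sqrt]
    rw [this, hS, Finset.sum_div, ← hS]
    simp only [hP, hc]
    push_cast
    exact Finset.sum_congr rfl fun k _ => by ring
  have hnorm : ‖P p‖ₑ ^ 2 = ENNReal.ofReal S := by
    rw [hval, ← ofReal_norm, Complex.norm_real, Real.norm_of_nonneg (Real.sqrt_nonneg S),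
      ← ENNReal.ofReal_pow (Real.sqrt_nonneg S), Real.sq_sqrt hS0]
  rw [← hnorm]
  have hPd : Differentiable ℂ P := by
    simp only [hP]; fun_prop
  refine le_iSup₂_of_le (fun x : ℂ × ℂ => P x.2)
    ⟨(hPd.comp differentiable_snd).differentiableOn, ?_⟩ le_rfl
  rw [← lintegral_indicator hopen.measurableSet, Measure.volume_eq_prod, lintegral_prod_symm]
  swap
  · exact (((hPd.continuous.comp continuous_snd).enorm.measurable.pow_const 2).indicator
      hopen.measurableSet).aemeasurable
  have e1 : ∀ w : ℂ, ∫⁻ z, (eggDomain μ).indicator (fun x : ℂ × ℂ => ‖P x.2‖ₑ ^ 2) (z, w) =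
      ENNReal.ofReal (Real.pi * (1 - ‖w‖ ^ (2 * μ))) * ‖P w‖ₑ ^ 2 := by
    intro w
    have hm : MeasurableSet {z : ℂ | ‖z‖ ^ 2 < 1 - ‖w‖ ^ (2 * μ)} :=
      (isOpen_lt (by fun_prop) continuous_const).measurableSet
    rw [← volume_norm_sq_lt, mul_comm, ← setLIntegral_const, ← lintegral_indicator hm]
    refine lintegral_congr fun z => ?_
    by_cases hz : (z, w) ∈ eggDomain μ
    · rw [indicator_of_mem hz, indicator_of_mem (show z ∈ {z : ℂ | ‖z‖ ^ 2 < 1 - ‖w‖ ^ (2 * μ)} from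
        mem_eggDomain_iff.1 hz)]
    · rw [indicator_of_notMem hz,
        indicator_of_notMem (show z ∉ {z : ℂ | ‖z‖ ^ 2 < 1 - ‖w‖ ^ (2 * μ)} from
          fun h => hz (mem_eggDomain_iff.2 h))]
  simp_rw [e1]
  rw [lintegral_radial_mul_enorm_sq
    (Φ := fun r => ENNReal.ofReal (Real.pi * (1 - r ^ (2 * μ))))
    (hPd.continuous.continuousOn (s := Metric.ball 0 1))
    measurable_eggWeight fun r hr => eggDomain_weight_nonpos hμ hr]
  have e2 : ∀ r ∈ Ioo (0 : ℝ) 1, ENNReal.ofReal (2 * Real.pi * r *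
      Real.circleAverage (fun w => ‖P w‖ ^ 2) 0 r) * ENNReal.ofReal (Real.pi * (1 - r ^ (2 * μ))) =
      ENNReal.ofReal (2 * Real.pi * r * ∑ k ∈ Finset.range N, ‖c k‖ ^ 2 * r ^ (2 * k)) *
        ENNReal.ofReal (Real.pi * (1 - r ^ (2 * μ))) := by
    intro r hr
    rw [circleAverage_norm_sum_sq N c hr.1.le]
  rw [setLIntegral_congr_fun measurableSet_Ioo e2,
    lintegral_Ioo_sum_mul_eggWeight hμ N _ fun k => sq_nonneg _, ENNReal.ofReal_le_one]
  apply le_of_eq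
  have e3 : ∀ k, ‖c k‖ ^ 2 * eggMoment μ k = p ^ (2 * k) / eggMoment μ k / S := by
    intro k
    have hk := eggMoment_pos hμ k
    rw [hc, Complex.norm_real, Real.norm_of_nonneg (by positivity), div_pow, Real.sq_sqrt hS0]
    field_simp
    ring
  simp_rw [e3]
  rw [← Finset.sum_div, ← hS, div_self h0.ne']

/-! ### The estimates -/

theorem mainTheorem5 (μ : ℝ) (hμ : 0 < μ) (hμ' : μ < 1 / 2) (p : ℝ) (hp : 0 ≤ p) (hp' : p < 1) :
    kobayashiF (eggDomain μ) ((0 : ℂ), (p : ℂ)) ≤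
        ENNReal.ofReal (1 / μ * ((1 - p ^ (2 * μ)) / (1 - p ^ 2))
          - (1 - μ) / (2 * μ) * (1 - p ^ (2 * μ))) ∧
      ENNReal.ofReal (p ^ (2 - 2 * μ) / (2 * μ ^ 3) * ((1 - p ^ (2 * μ)) / (1 - p ^ 2)) ^ 3
          * (1 + μ + p ^ 2 - μ * p ^ 2)) ≤
        kobayashiF (eggDomain μ) ((0 : ℂ), (p : ℂ)) := by
  have hp2 : 0 < 1 - p ^ 2 := by nlinarith
  have hc : 0 < 1 - p ^ (2 * μ) := by
    linarith [Real.rpow_lt_one hp hp' (by positivity : 0 < 2 * μ)]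
  have hnum : 0 ≤ 1 + μ + p ^ 2 - μ * p ^ 2 := by nlinarith
  have hK0 : 0 ≤ (1 + μ + p ^ 2 - μ * p ^ 2) / (Real.pi ^ 2 * μ * (1 - p ^ 2) ^ 3) := by
    positivity
  have hpi := Real.pi_pos
  constructor
  · have hvol := (measure_mono (μ := volume)
      (kobayashiIndicatrix_eggDomain_subset hμ (by linarith) hp hp')).trans_eq
      (volume_ellipsoid hc hp2)
    refine (mul_le_mul' (bergmanKernel_eggDomain_le hμ hp hp') hvol).trans_eq ?_
    rw [← ENNReal.ofReal_mul hK0]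
    congr 1
    field_simp
    ring
  · rcases hp.eq_or_lt with rfl | hp0
    · rw [Real.zero_rpow (by linarith), zero_div, zero_mul, zero_mul, ENNReal.ofReal_zero]
      exact zero_le
    have hB : 0 < p ^ (1 - μ) * (1 - p ^ (2 * μ)) / μ := by positivity
    have hvol := (volume_ellipsoid hc hB).symm.trans_le (measure_mono (μ := volume)
      (subset_kobayashiIndicatrix_eggDomain hμ hμ'.le hp0 hp'))
    refine le_trans (le_of_eq ?_) (mul_le_mul' (le_bergmanKernel_eggDomain hμ hp hp') hvol)
    rw [← ENNReal.ofReal_mul hK0]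
    congr 1
    have e : p ^ (2 - 2 * μ) = (p ^ (1 - μ)) ^ 2 := by
      rw [← Real.rpow_natCast, ← Real.rpow_mul hp0.le]
      push_cast
      ring_nf
    rw [e]
    field_simp
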